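/- Let $\mathbb{X}$ be a compact metric space, $\tau:\mathbb{X}\to[0,\infty)$ continuous, and $\xi=(\xi(x))_{x\in\mathbb{X}}$ a Gaussian process with continuous sample paths on a probability space $(\Omega,\mathcal{F},\mathbb{P})$. Let $(U_n)_{n\ge1}$ be i.i.d. $\mathcal{N}(0,1)$ variables independent of $\xi$. A sequential design is a sequence $(X_n)_{n\ge1}$ of $\mathbb{X}$-valued random variables such that, for all $n\ge1$, $X_n$ is $\mathcal{F}_{n-1}$-measurable, where $\mathcal{F}_n=\sigma(X_1,Z_1,\dots,X_n,Z_n)$ and $Z_n=\xi(X_n)+\tau(X_n)U_n$. Let $\mathbb{P}^\xi_n$ be the conditional distribution of $\xi$ given $\mathcal{F}_n$, viewed as a random measure on $C(\mathbb{X})$, and let $m_n(u)=\mathbb{E}[\xi(u)\mid\mathcal{F}_n]=\int f(u)\,\mathbb{P}_n^\xi(df)$ be its mean function. For a Gaussian measure $\nu$ on $C(\mathbb{X})$ with mean function $m_\nu$, set $$\mathcal{H}(\nu)=\int \max_{u\in\mathbb{X}} f(u)\,\nu(df)-\max_{u\in\mathbb{X}} m_\nu(u)$$ (the knowledge-gradient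 uncertainty functional), and, for $x\in\mathbb{X}$, $$\mathcal{J}_x(\nu)=\iint \mathcal{H}\bigl(\mathrm{Cond}_{x,\,f(x)+\tau(x)u}(\nu)\bigr)\,\nu(df)\,\phi(u)\,du ,$$ where $\phi$ is the standard normal density and $\mathrm{Cond}_{x,z}(\nu)$ denotes the conditional distribution of $f$ given $f(x)+\tau(x)u=z$ when $f\sim\nu$ and $u\sim\mathcal{N}(0,1)$ are independent. Put $J_n(x)=\mathcal{J}_x(\mathbb{P}^\xi_n)$. A sequential design is called a SUR design for $\mathcal{H}$ if there is $n_0$ such that, for all $n\ge n_0$, $X_{n+1}\in\arg\min_{x} J_n(x)$ almost surely, and a quasi-SUR design for $\mathcal{H}$ if there are real numbers $\varepsilon_n>0$ with $\varepsilon_n\to0$ and an integer $n_0$ such that, for all $n\ge n_0$, $J_n(X_{n+1})\le\inf_{x}J_n(x)+\varepsilon_n$ almost surely. Let $(X_n)$ be a SUR or quasi-SUR design for $\mathcal{H}$, and let $(x_n^*)_{n\ge0}$ be any sequence of $\mathbb{X}$-valued random variables such that $x_n^*$ is $\mathcal{F}_n$-measurable and $x_n^*\in\arg\max_{u\in\mathbb{X}}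 m_n(u)$ almost surely, for every $n$. Then, as $n\to\infty$, $$\xi(x_n^*)\to\max_{u\in\mathbb{X}}\xi(u)\quad\text{almost surely and in } L^1 .$$ -/

import Mathlib

open MeasureTheory ProbabilityTheory Filter Topology

noncomputable section

namespace SeqDesign

/-- The Banach space `C(𝕏, ℝ)` (supremum norm) carries its Borel `σ`-algebra. -/
instance instMeasurableSpacePaths {𝕏 : Type*} [TopologicalSpace 𝕏] :
    MeasurableSpace C(𝕏, ℝ) := borel _

instance instBorelSpacePaths {𝕏 : Type*} [TopologicalSpace 𝕏] : BorelSpace C(𝕏, ℝ) := ⟨rfl⟩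

variable {𝕏 Ω : Type*}

/-! ### The observation model and sequential designs

Indices start at `0`: `X n`, `U n` and `obs τ ξ U X n` are the `(n+1)`-st design point, the
`(n+1)`-st noise variable and the `(n+1)`-st observation. -/

section Model

variable [TopologicalSpace 𝕏]

/-- The noisy observation `Z = ξ(X) + τ(X) U` made at the design point `X n`. -/
def obs (τ : 𝕏 → ℝ) (ξ : Ω → C(𝕏, ℝ)) (U : ℕ → Ω → ℝ) (X : ℕ → Ω → 𝕏) (n : ℕ) (ω : Ω) : ℝ :=
  ξ ω (X n ω) + τ (X n ω) * U n ω

/-- The data available after `n` observations: the first `n` pairs (design point, observation). -/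
def history (τ : 𝕏 → ℝ) (ξ : Ω → C(𝕏, ℝ)) (U : ℕ → Ω → ℝ) (X : ℕ → Ω → 𝕏) (n : ℕ) (ω : Ω) :
    Fin n → 𝕏 × ℝ :=
  fun i => (X i ω, obs τ ξ U X i ω)

variable [MeasurableSpace 𝕏]

/-- The `σ`-algebra `ℱ_n` generated by the first `n` design points and observations. -/
abbrev dataAlgebra (τ : 𝕏 → ℝ) (ξ : Ω → C(𝕏, ℝ)) (U : ℕ → Ω → ℝ) (X : ℕ → Ω → 𝕏) (n : ℕ) :
    MeasurableSpace Ω :=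
  MeasurableSpace.comap (history τ ξ U X n) inferInstance

/-- `X` is a (non-randomized) sequential design: each design point is a measurable function of
the data collected before it. -/
def IsSequentialDesign (τ : 𝕏 → ℝ) (ξ : Ω → C(𝕏, ℝ)) (U : ℕ → Ω → ℝ) (X : ℕ → Ω → 𝕏) : Prop :=
  ∀ n, Measurable[dataAlgebra τ ξ U X n] (X n)

end Model

/-! ### Posterior distributions and the knowledge gradient functional -/

section Posterior

variable [MetricSpace 𝕏] [CompactSpace 𝕏]

/-- The mean function `m_ν` of a measure `ν` on `C(𝕏, ℝ)`. -/
def meanFun (ν : Measure C(𝕏, ℝ)) (u : 𝕏) : ℝ := ∫ f, f u ∂ν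

/-- The knowledge gradient uncertainty functional
`ℋ(ν) = ∫ max f ν(df) - max m_ν`. -/
def kgUncertainty (ν : Measure C(𝕏, ℝ)) : ℝ :=
  (∫ f, (⨆ u, f u) ∂ν) - ⨆ u, meanFun ν u

/-- One-step conditioning. If `f` has law `ν`, `u` is standard normal and independent of `f`, then
`condAt τ x ν z` is the (regular) conditional distribution of `f` given `f x + τ x * u = z`. -/
def condAt (τ : 𝕏 → ℝ) (x : 𝕏) (ν : Measure C(𝕏, ℝ)) [IsFiniteMeasure ν] (z : ℝ) :
    Measure C(𝕏, ℝ) :=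
  condDistrib (fun p : C(𝕏, ℝ) × ℝ => p.1) (fun p : C(𝕏, ℝ) × ℝ => p.1 x + τ x * p.2)
    (ν.prod (gaussianReal 0 1)) z

/-- The expected residual uncertainty `𝒥_x(ν)` after one more observation at `x`: the average of
`ℋ(condAt τ x ν z)` over the law of the observation `z = f x + τ x * u`. It does not depend on the
version of the conditional distribution, which is unique for almost every such `z`. -/
def expectedResidual (τ : 𝕏 → ℝ) (x : 𝕏) (ν : Measure C(𝕏, ℝ)) [IsFiniteMeasure ν] : ℝ :=
  ∫ p : C(𝕏, ℝ) × ℝ, kgUncertainty (condAt τ x ν (p.1 x + τ x * p.2))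
    ∂(ν.prod (gaussianReal 0 1))

variable [MeasurableSpace 𝕏] [MeasurableSpace Ω]

/-- The posterior `ℙ_n^ξ`: the (regular) conditional distribution of `ξ` given the data after
`n` observations. -/
def posterior (P : Measure Ω) [IsFiniteMeasure P] (τ : 𝕏 → ℝ) (ξ : Ω → C(𝕏, ℝ))
    (U : ℕ → Ω → ℝ) (X : ℕ → Ω → 𝕏) (n : ℕ) (ω : Ω) : Measure C(𝕏, ℝ) :=
  condDistrib ξ (history τ ξ U X n) P (history τ ξ U X n ω)

instance instIsProbabilityMeasurePosterior (P : Measure Ω) [IsFiniteMeasure P] (τ : 𝕏 → ℝ)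
    (ξ : Ω → C(𝕏, ℝ)) (U : ℕ → Ω → ℝ) (X : ℕ → Ω → 𝕏) (n : ℕ) (ω : Ω) :
    IsProbabilityMeasure (posterior P τ ξ U X n ω) := by
  unfold posterior; infer_instance

/-- The sampling criterion `J_n(x) = 𝒥_x(ℙ_n^ξ)`. -/
def kgCriterion (P : Measure Ω) [IsFiniteMeasure P] (τ : 𝕏 → ℝ) (ξ : Ω → C(𝕏, ℝ))
    (U : ℕ → Ω → ℝ) (X : ℕ → Ω → 𝕏) (n : ℕ) (x : 𝕏) (ω : Ω) : ℝ :=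
  expectedResidual τ x (posterior P τ ξ U X n ω)

/-- SUR design for the knowledge gradient functional: from some step on, the next point
minimizes `J_n` over `𝕏` (almost surely, so that the version of the posterior is irrelevant). -/
def IsSUR (P : Measure Ω) [IsFiniteMeasure P] (τ : 𝕏 → ℝ) (ξ : Ω → C(𝕏, ℝ))
    (U : ℕ → Ω → ℝ) (X : ℕ → Ω → 𝕏) : Prop :=
  IsSequentialDesign τ ξ U X ∧
  ∃ n₀ : ℕ, ∀ n ≥ n₀, ∀ᵐ ω ∂P, ∀ x : 𝕏,
    kgCriterion P τ ξ U X n (X n ω) ω ≤ kgCriterion P τ ξ U X n x ω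

/-- `ε`-quasi-SUR design for the knowledge gradient functional: from some step on,
`J_n(X_{n+1}) ≤ inf J_n + ε_n`, where `ε_n > 0` and `ε_n → 0`. -/
def IsQuasiSUR (P : Measure Ω) [IsFiniteMeasure P] (τ : 𝕏 → ℝ) (ξ : Ω → C(𝕏, ℝ))
    (U : ℕ → Ω → ℝ) (X : ℕ → Ω → 𝕏) (ε : ℕ → ℝ) : Prop :=
  IsSequentialDesign τ ξ U X ∧ (∀ n, 0 < ε n) ∧ Tendsto ε atTop (𝓝 0) ∧
  ∃ n₀ : ℕ, ∀ n ≥ n₀, ∀ᵐ ω ∂P, ∀ x : 𝕏,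
    kgCriterion P τ ξ U X n (X n ω) ω ≤ kgCriterion P τ ξ U X n x ω + ε n

end Posterior

end SeqDesign

end

/-!
The proof avoids the general theory of uncertainty functionals and works with the *gain*
`𝒢_x(ν) = ℋ(ν) - 𝒥_x(ν)`. As the expected maximum of the paths is unchanged on average by
conditioning, `𝒢_x(ν)` is the expected increase of the maximum of the mean function when one
observes at `x` (`kgUncertainty_sub_expectedResidual`).

*The gains at the design points tend to `0`.* A Gaussian measure on a Banach space has an explicit
conditional law given one noisy linear observation, namely a translate of the law of the residual
of a regression (`condDistrib_noisyObs_ae_eq`). This update is measurable in the past, so it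
yields the next posterior from the current one. Starting from the law of `ξ`, which is a Gaussian
measure on `C(𝕏, ℝ)` by approximation (`isGaussian_map_of_isGaussianProcess`), all posteriors are
therefore Gaussian (`ae_isGaussian_posterior`). Hence the expected gain at `X n` is the increment of
`𝔼[max m_n]`, which is increasing and bounded by `𝔼[max ξ]`. The expected gains are
thus summable, and the gains tend to `0` almost surely (`ae_tendsto_knowledgeGain`). By
(quasi-)optimality of the design, `sup_x 𝒢_x` of the `n`-th posterior tends to `0` as well.

*Small gains force small variances.* Let `v` maximize the mean of a Gaussian `ν`. After an
observation at `x`, the mean difference between `u` and `v` is a normal variable with standard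
deviation `|cov (f u - f v, f x)| / sd Z`, where `Z` is the observation, and the gain is at least
the mean of its positive part (`posExcess_le_knowledgeGain`). Taking `x = u` and `x = v` bounds the variance of
`f u - f v` (`posExcess_le_of_variance_ge`). The moments of the posteriors are almost surely
bounded, as convergent martingales, so the posterior variances of all increments `ξ u - ξ v` tend to
`0` (`ae_tendsto_variance`).

*Conclusion.* Consequently every increment of `ξ` is determined by the data, and the posterior mean
increments converge to it by Lévy's upward theorem (`ae_tendsto_meanFun_sub`). Interpolation at
finitely many points makes this convergence uniform over `𝕏`
(`ae_eventually_abs_increment_sub_le`). The values of `ξ` themselves need not be learnt, but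
increments suffice to compare `ξ` at a maximizer of `m_n` with its maximum. Convergence in `L¹` is
dominated convergence, with the dominating function `2 ‖ξ‖`.
-/

namespace SeqDesign

/-! ### Interpolation by partitions of unity and the supremum functional -/

section Interpolation

variable {𝕏 : Type*} [MetricSpace 𝕏]

/-- The interpolation `∑ x ∈ s, f x • φ x` of `f` at the nodes `s`, with weight functions `φ`. -/
noncomputable def interp (s : Finset 𝕏) (φ : 𝕏 → C(𝕏, ℝ)) (f : C(𝕏, ℝ)) : C(𝕏, ℝ) :=
  ∑ x ∈ s, f x • φ x

lemma interp_apply (s : Finset 𝕏) (φ : 𝕏 → C(𝕏, ℝ)) (f : C(𝕏, ℝ)) (u : 𝕏) :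
    interp s φ f u = ∑ x ∈ s, f x * φ x u := by
  simp [interp, ContinuousMap.sum_apply]

lemma abs_sum_mul_le {s : Finset 𝕏} {φ : 𝕏 → C(𝕏, ℝ)} (h0 : ∀ x u, 0 ≤ φ x u)
    (h1 : ∀ u, ∑ x ∈ s, φ x u = 1) (u : 𝕏) (g : 𝕏 → ℝ) {C : ℝ}
    (hg : ∀ x ∈ s, φ x u ≠ 0 → |g x| ≤ C) : |∑ x ∈ s, g x * φ x u| ≤ C := by
  calc |∑ x ∈ s, g x * φ x u| ≤ ∑ x ∈ s, |g x * φ x u| := Finset.abs_sum_le_sum_abs _ _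
    _ ≤ ∑ x ∈ s, C * φ x u := by
        refine Finset.sum_le_sum fun x hx => ?_
        rw [abs_mul, abs_of_nonneg (h0 x u)]
        by_cases h : φ x u = 0
        · simp [h]
        · exact mul_le_mul_of_nonneg_right (hg x hx h) (h0 x u)
    _ = C := by rw [← Finset.mul_sum, h1, mul_one]

variable [CompactSpace 𝕏]

lemma continuous_interp (s : Finset 𝕏) (φ : 𝕏 → C(𝕏, ℝ)) : Continuous (interp s φ) := by
  unfold interp
  refine continuous_finsetSum _ fun x _ => ?_
  exact (continuous_eval_const (F := C(𝕏, ℝ)) x).smul continuous_const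

lemma norm_interp_le {s : Finset 𝕏} {φ : 𝕏 → C(𝕏, ℝ)} (h0 : ∀ x u, 0 ≤ φ x u)
    (h1 : ∀ u, ∑ x ∈ s, φ x u = 1) (f : C(𝕏, ℝ)) : ‖interp s φ f‖ ≤ ‖f‖ := by
  refine (ContinuousMap.norm_le _ (norm_nonneg f)).2 fun u => ?_
  rw [interp_apply, Real.norm_eq_abs]
  exact abs_sum_mul_le h0 h1 u _ fun x _ _ => f.norm_coe_le_norm x

/-- A finite partition of unity by functions supported in small balls; the weights are normalized
tent functions. -/
lemma exists_partition_of_unity (𝕏 : Type*) [MetricSpace 𝕏] [CompactSpace 𝕏] {ε : ℝ} (hε : 0 < ε) :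
    ∃ (s : Finset 𝕏) (φ : 𝕏 → C(𝕏, ℝ)), (∀ x u, 0 ≤ φ x u) ∧ (∀ u, ∑ x ∈ s, φ x u = 1) ∧
      ∀ x u, φ x u ≠ 0 → dist u x < ε := by
  obtain ⟨t, -, htf, ht⟩ := (isCompact_univ (X := 𝕏)).finite_cover_balls hε
  lift t to Finset 𝕏 using htf
  let g : 𝕏 → C(𝕏, ℝ) := fun x => ⟨fun u => max 0 (ε - dist u x), by fun_prop⟩
  have hg0 : ∀ x u, 0 ≤ g x u := fun x u => le_max_left _ _
  have hpos : ∀ u, 0 < ∑ x ∈ t, g x u := by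
    intro u
    obtain ⟨x, hx, hux⟩ := Set.mem_iUnion₂.1 (ht (Set.mem_univ u))
    refine Finset.sum_pos' (fun x _ => hg0 x u) ⟨x, hx, ?_⟩
    exact lt_max_of_lt_right (sub_pos.2 hux)
  refine ⟨t, fun x => ⟨fun u => g x u / ∑ y ∈ t, g y u, ?_⟩, fun x u => ?_, fun u => ?_, ?_⟩
  · exact (g x).continuous.div (continuous_finsetSum _ fun y _ => (g y).continuous)
      fun u => (hpos u).ne'
  · exact div_nonneg (hg0 x u) (hpos u).le
  · simp only [ContinuousMap.coe_mk]
    rw [← Finset.sum_div, div_self (hpos u).ne']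
  · intro x u h
    by_contra hlt
    exact h (by simp [g, max_eq_left (sub_nonpos.2 (not_lt.1 hlt))])

/-- Interpolation schemes with mesh tending to `0`: they converge uniformly on each continuous
function. -/
lemma exists_interp_tendsto (𝕏 : Type*) [MetricSpace 𝕏] [CompactSpace 𝕏] :
    ∃ (s : ℕ → Finset 𝕏) (φ : ℕ → 𝕏 → C(𝕏, ℝ)), (∀ k x u, 0 ≤ φ k x u) ∧
      (∀ k u, ∑ x ∈ s k, φ k x u = 1) ∧
      ∀ f : C(𝕏, ℝ), Tendsto (fun k => interp (s k) (φ k) f) atTop (𝓝 f) := by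
  choose s φ h0 h1 h2 using fun k : ℕ =>
    exists_partition_of_unity 𝕏 (Nat.one_div_pos_of_nat (α := ℝ) (n := k))
  refine ⟨s, φ, h0, h1, fun f => ?_⟩
  rw [Metric.tendsto_atTop]
  intro ε hε
  obtain ⟨δ, hδ, hf⟩ := Metric.uniformContinuous_iff.1
    (CompactSpace.uniformContinuous_of_continuous f.continuous) (ε / 2) (half_pos hε)
  obtain ⟨N, hN⟩ := exists_nat_one_div_lt hδ
  refine ⟨N, fun k hk => lt_of_le_of_lt ?_ (half_lt_self hε)⟩
  rw [dist_eq_norm]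
  refine (ContinuousMap.norm_le _ (half_pos hε).le).2 fun u => ?_
  have : (interp (s k) (φ k) f - f) u = ∑ x ∈ s k, (f x - f u) * φ k x u := by
    simp only [ContinuousMap.sub_apply, interp_apply, sub_mul, Finset.sum_sub_distrib,
      ← Finset.mul_sum, h1, mul_one]
  rw [this, Real.norm_eq_abs]
  refine abs_sum_mul_le (h0 k) (h1 k) u _ fun x _ hx => ?_
  have h3 : dist x u < δ := by
    rw [dist_comm]
    refine (h2 k x u hx).trans_le (le_trans ?_ hN.le)
    exact Nat.one_div_le_one_div hk
  exact (hf h3).le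

/-- A map into `C(𝕏, ℝ)` is measurable as soon as its evaluations are. -/
lemma measurable_of_eval {Ω : Type*} [MeasurableSpace Ω] {ξ : Ω → C(𝕏, ℝ)}
    (h : ∀ x, Measurable fun ω => ξ ω x) : Measurable ξ := by
  obtain ⟨s, φ, -, -, hlim⟩ := exists_interp_tendsto 𝕏
  refine measurable_of_tendsto_metrizable (f := fun k ω => interp (s k) (φ k) (ξ ω)) (fun k => ?_)
    (tendsto_pi_nhds.2 fun ω => hlim (ξ ω))
  unfold interp
  refine Finset.measurable_sum _ fun x _ => ?_
  exact (continuous_id.smul continuous_const).measurable.comp (h x)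

lemma bddAbove_range_coe (f : C(𝕏, ℝ)) : BddAbove (Set.range f) :=
  (isCompact_range f.continuous).bddAbove

lemma le_sup (f : C(𝕏, ℝ)) (u : 𝕏) : f u ≤ ⨆ u, f u := le_ciSup (bddAbove_range_coe f) u

section Sup

variable [Nonempty 𝕏]

lemma sup_le_sup_add_norm_sub (f g : C(𝕏, ℝ)) : (⨆ u, f u) ≤ (⨆ u, g u) + ‖f - g‖ := by
  refine ciSup_le fun u => ?_
  have h1 := (f - g).norm_coe_le_norm u
  have h2 := le_sup g u
  have h3 := le_abs_self (f u - g u)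
  simp only [ContinuousMap.sub_apply, Real.norm_eq_abs] at h1
  linarith

lemma abs_sup_sub_sup_le (f g : C(𝕏, ℝ)) : |(⨆ u, f u) - ⨆ u, g u| ≤ ‖f - g‖ := by
  rw [abs_le]
  have h1 := sup_le_sup_add_norm_sub f g
  have h2 := sup_le_sup_add_norm_sub g f
  rw [norm_sub_rev] at h2
  constructor <;> linarith

lemma continuous_sup : Continuous fun f : C(𝕏, ℝ) => ⨆ u, f u := by
  have : LipschitzWith 1 fun f : C(𝕏, ℝ) => ⨆ u, f u :=
    LipschitzWith.of_dist_le_mul fun f g => by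
      rw [Real.dist_eq, dist_eq_norm]
      simpa using abs_sup_sub_sup_le f g
  exact this.continuous

lemma abs_sup_le_norm (f : C(𝕏, ℝ)) : |⨆ u, f u| ≤ ‖f‖ := by
  have := abs_sup_sub_sup_le f 0
  simpa using this

lemma integrable_sup {Ω : Type*} [MeasurableSpace Ω] {P : Measure Ω} {ξ : Ω → C(𝕏, ℝ)}
    (h : Integrable ξ P) : Integrable (fun ω => ⨆ u, ξ ω u) P :=
  h.norm.mono' (continuous_sup.comp_aestronglyMeasurable h.1) (ae_of_all _ fun ω => by
    rw [Real.norm_eq_abs]; exact abs_sup_le_norm _)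

end Sup

/-- Where paths are integrable in norm, the mean function is the Bochner integral in `C(𝕏, ℝ)`. -/
lemma meanFun_eq {ν : Measure C(𝕏, ℝ)} (h : Integrable (fun f : C(𝕏, ℝ) => f) ν) (u : 𝕏) :
    meanFun ν u = (∫ f, f ∂ν) u :=
  (ContinuousMap.evalCLM (M := ℝ) ℝ u).integral_comp_comm h

end Interpolation

/-! ### Limits of Gaussian variables, and the law of a continuous Gaussian process -/

section GaussianLimit

variable {Ω : Type*} [MeasurableSpace Ω]

/-- If the characteristic functions `exp (i t m n)` of Dirac masses converge to a function that is
continuous at `0`, then the atoms `m n` stay bounded, by tightness. -/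
lemma exists_bound_of_tendsto_charFun_dirac {m : ℕ → ℝ} {g : ℝ → ℂ} (hg : ContinuousAt g 0)
    (h : ∀ t : ℝ, Tendsto (fun n => Complex.exp (t * m n * Complex.I)) atTop (𝓝 (g t))) :
    ∃ K : Set ℝ, IsCompact K ∧ ∀ n, m n ∈ K := by
  have ht : IsTightMeasureSet (Set.range fun n => Measure.dirac (m n)) := by
    refine isTightMeasureSet_of_tendsto_charFun hg fun t => ?_
    simpa [charFun_dirac, mul_comm] using h t
  rw [isTightMeasureSet_iff_exists_isCompact_measure_compl_le] at ht
  obtain ⟨K, hK, hle⟩ := ht (1 / 2) (by simp)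
  refine ⟨K, hK, fun n => ?_⟩
  by_contra hn
  have h1 := hle _ ⟨n, rfl⟩
  simp only at h1
  rw [Measure.dirac_apply' _ hK.measurableSet.compl, Set.indicator_of_mem hn] at h1
  simp at h1

/-- A pointwise limit of real Gaussian random variables is Gaussian. -/
lemma hasGaussianLaw_of_tendsto {P : Measure Ω} [IsProbabilityMeasure P] {Y : ℕ → Ω → ℝ}
    {Z : Ω → ℝ} (hY : ∀ n, HasGaussianLaw (Y n) P) (hYm : ∀ n, Measurable (Y n))
    (hlim : ∀ ω, Tendsto (fun n => Y n ω) atTop (𝓝 (Z ω))) : HasGaussianLaw Z P := by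
  have hZm : Measurable Z := measurable_of_tendsto_metrizable hYm (tendsto_pi_nhds.2 hlim)
  have : IsProbabilityMeasure (P.map Z) := Measure.isProbabilityMeasure_map hZm.aemeasurable
  set m : ℕ → ℝ := fun n => P[Y n]
  set v : ℕ → ℝ := fun n => Var[Y n; P]
  have hv0 : ∀ n, 0 ≤ v n := fun n => variance_nonneg _ _
  have hchar : ∀ n (t : ℝ), charFun (P.map (Y n)) t
      = Complex.exp (t * m n * Complex.I - v n * t ^ 2 / 2) := fun n t => by
    rw [(hY n).map_eq_gaussianReal, charFun_gaussianReal, Real.coe_toNNReal _ (hv0 n)]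
  have hconv : ∀ t, Tendsto (fun n => charFun (P.map (Y n)) t) atTop (𝓝 (charFun (P.map Z) t)) := by
    intro t
    have e : ∀ {W : Ω → ℝ}, Measurable W → charFun (P.map W) t
        = ∫ ω, Complex.exp (t * W ω * Complex.I) ∂P := fun {W} hW => by
      rw [charFun_apply_real, integral_map hW.aemeasurable (by fun_prop)]
    simp_rw [e (hYm _), e hZm]
    refine tendsto_integral_of_dominated_convergence (fun _ => 1) (fun n => ?_)
      (integrable_const _) (fun n => ae_of_all _ fun ω => ?_) (ae_of_all _ fun ω => ?_)
    · have := hYm n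
      exact (by fun_prop : Measurable _).aestronglyMeasurable
    · rw [← Complex.ofReal_mul, Complex.norm_exp_ofReal_mul_I]
    · have hc : Continuous fun y : ℝ => Complex.exp (t * y * Complex.I) := by fun_prop
      exact (hc.tendsto _).comp (hlim ω)
  have hcont : Continuous (charFun (P.map Z)) := continuous_charFun
  -- the variances converge, because the modulus of the limit does not vanish near the origin
  obtain ⟨t₀, ht₀, hne⟩ : ∃ t₀ : ℝ, t₀ ≠ 0 ∧ charFun (P.map Z) t₀ ≠ 0 := by
    have h0 : charFun (P.map Z) 0 ≠ 0 := by simp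
    have hev : ∀ᶠ t in 𝓝 (0 : ℝ), charFun (P.map Z) t ≠ 0 :=
      hcont.continuousAt.eventually_ne h0
    have hev' : ∀ᶠ t in 𝓝[≠] (0 : ℝ), t ≠ 0 ∧ charFun (P.map Z) t ≠ 0 :=
      (eventually_mem_nhdsWithin).and (hev.filter_mono nhdsWithin_le_nhds)
    exact hev'.exists
  have hnorm : ∀ n (t : ℝ), ‖charFun (P.map (Y n)) t‖ = Real.exp (-(v n * t ^ 2 / 2)) := by
    intro n t
    rw [hchar, Complex.norm_exp]
    congr 1
    have : (t * m n * Complex.I - v n * t ^ 2 / 2 : ℂ)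
        = ((-(v n * t ^ 2 / 2) : ℝ) : ℂ) + ((t * m n : ℝ) : ℂ) * Complex.I := by
      push_cast; ring
    rw [this]
    simp only [Complex.add_re, Complex.ofReal_re, Complex.re_ofReal_mul, Complex.I_re, mul_zero,
      add_zero]
  obtain ⟨w, hw⟩ : ∃ w, Tendsto v atTop (𝓝 w) := by
    have h1 := ((hconv t₀).norm.log (norm_ne_zero_iff.2 hne)).const_mul (-2 / t₀ ^ 2)
    refine ⟨_, h1.congr fun n => ?_⟩
    rw [hnorm, Real.log_exp]
    field_simp
  have hw0 : 0 ≤ w := ge_of_tendsto' hw hv0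
  -- dividing out the variance part shows that the means are bounded, so that they converge along a
  -- subsequence
  have hmean : ∀ t : ℝ, Tendsto (fun n => Complex.exp (t * m n * Complex.I)) atTop
      (𝓝 (charFun (P.map Z) t * Complex.exp (w * t ^ 2 / 2))) := by
    intro t
    have h2 : Tendsto (fun n => Complex.exp ((v n : ℂ) * t ^ 2 / 2)) atTop
        (𝓝 (Complex.exp (w * t ^ 2 / 2))) := by
      have hc : Continuous fun y : ℝ => Complex.exp ((y : ℂ) * t ^ 2 / 2) := by fun_prop
      exact (hc.tendsto w).comp hw
    refine ((hconv t).mul h2).congr fun n => ?_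
    rw [hchar, ← Complex.exp_add]
    congr 1; ring
  obtain ⟨K, hK, hmK⟩ := exists_bound_of_tendsto_charFun_dirac
    (g := fun t => charFun (P.map Z) t * Complex.exp (w * t ^ 2 / 2))
    (by fun_prop) hmean
  obtain ⟨a, -, θ, hθ, ha⟩ := hK.tendsto_subseq hmK
  have hlaw : P.map Z = gaussianReal a w.toNNReal := by
    refine Measure.ext_of_charFun ?_
    ext t
    refine tendsto_nhds_unique ((hconv t).comp hθ.tendsto_atTop) ?_
    rw [charFun_gaussianReal, Real.coe_toNNReal _ hw0]
    have hc : Continuous fun p : ℝ × ℝ => Complex.exp (t * p.1 * Complex.I - p.2 * t ^ 2 / 2) := by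
      fun_prop
    refine ((hc.tendsto (a, w)).comp
      (ha.prodMk_nhds (hw.comp hθ.tendsto_atTop))).congr fun n => ?_
    simp [hchar]
  exact ⟨by rw [hlaw]; infer_instance⟩

/-- The law on `C(𝕏, ℝ)` of a Gaussian process with continuous paths is a Gaussian measure:
a continuous functional of the process is the pointwise limit of the same functional of its
interpolations, which are finite linear combinations of values of the process. -/
lemma isGaussian_map_of_isGaussianProcess {𝕏 : Type*} [MetricSpace 𝕏] [CompactSpace 𝕏]
    {P : Measure Ω} [IsProbabilityMeasure P] {ξ : Ω → C(𝕏, ℝ)}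
    (hm : ∀ x, Measurable fun ω => ξ ω x) (hξ : IsGaussianProcess (fun x ω => ξ ω x) P) :
    IsGaussian (P.map ξ) := by
  obtain ⟨s, φ, -, -, hlim⟩ := exists_interp_tendsto 𝕏
  have hξm := measurable_of_eval hm
  refine isGaussian_of_isGaussian_map fun L => ?_
  rw [Measure.map_map L.continuous.measurable hξm]
  have hL : ∀ k ω, L (interp (s k) (φ k) (ξ ω)) = ∑ x ∈ s k, L (φ k x) * ξ ω x := by
    intro k ω
    simp [interp, map_sum, mul_comm]
  refine (hasGaussianLaw_of_tendsto (Y := fun k ω => L (interp (s k) (φ k) (ξ ω)))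
    (fun k => ?_) (fun k => ?_) fun ω => ?_).isGaussian_map
  · simp_rw [hL]
    exact (hξ.smul (fun x => L (φ k x))).hasGaussianLaw_fun_sum (I := s k)
  · exact (L.continuous.comp (continuous_interp _ _)).measurable.comp hξm
  · exact (L.continuous.tendsto _).comp (hlim (ξ ω))

end GaussianLimit

/-! ### Conditioning a Gaussian measure on one noisy linear observation -/

section Conditioning

variable {E : Type*} [NormedAddCommGroup E] [NormedSpace ℝ E]

/-- The observation `ℓ f + t u` of the pair `(f, u)`, where `u` is the noise. -/
noncomputable def noisyObs (ℓ : StrongDual ℝ E) (t : ℝ) : StrongDual ℝ (E × ℝ) :=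
  ℓ.comp (ContinuousLinearMap.fst ℝ E ℝ) + t • ContinuousLinearMap.snd ℝ E ℝ

variable [MeasurableSpace E]

/-- The joint law of the unknown, with prior `ν`, and of an independent standard normal noise. -/
noncomputable abbrev withNoise (ν : Measure E) : Measure (E × ℝ) := ν.prod (gaussianReal 0 1)

/-- The variance of the noisy observation. -/
noncomputable def obsVar (ν : Measure E) (ℓ : StrongDual ℝ E) (t : ℝ) : ℝ :=
  Var[noisyObs ℓ t; withNoise ν]

/-- The covariance, an element of `E`, between the unknown and the noisy observation. -/
noncomputable def crossCov (ν : Measure E) (ℓ : StrongDual ℝ E) (t : ℝ) : E :=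
  ∫ p, (noisyObs ℓ t p - ∫ q, noisyObs ℓ t q ∂withNoise ν) • p.1 ∂withNoise ν

/-- The regression coefficient of the unknown on the noisy observation; it is `0` if the
observation is deterministic. -/
noncomputable def regression (ν : Measure E) (ℓ : StrongDual ℝ E) (t : ℝ) : E :=
  (obsVar ν ℓ t)⁻¹ • crossCov ν ℓ t

/-- What remains of the unknown after subtracting its regression on the noisy observation. -/
noncomputable def residual (ν : Measure E) (ℓ : StrongDual ℝ E) (t : ℝ) : E × ℝ →L[ℝ] E :=
  ContinuousLinearMap.fst ℝ E ℝ - (noisyObs ℓ t).smulRight (regression ν ℓ t)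

lemma residual_apply (ν : Measure E) (ℓ : StrongDual ℝ E) (t : ℝ) (p : E × ℝ) :
    residual ν ℓ t p = p.1 - noisyObs ℓ t p • regression ν ℓ t := rfl

lemma residual_add (ν : Measure E) (ℓ : StrongDual ℝ E) (t : ℝ) (p : E × ℝ) :
    residual ν ℓ t p + noisyObs ℓ t p • regression ν ℓ t = p.1 := by
  simp [residual_apply]

variable [BorelSpace E] (ν : Measure E) [IsGaussian ν] (ℓ : StrongDual ℝ E) (t : ℝ)

lemma memLp_noisyObs : MemLp (noisyObs ℓ t) 2 (withNoise ν) :=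
  IsGaussian.memLp_dual _ _ 2 (by simp)

lemma memLp_comp_fst (L : StrongDual ℝ E) : MemLp (fun p : E × ℝ => L p.1) 2 (withNoise ν) :=
  IsGaussian.memLp_dual (withNoise ν) (L.comp (ContinuousLinearMap.fst ℝ E ℝ)) 2 (by simp)

lemma hasGaussianLaw_residual_noisyObs :
    HasGaussianLaw (fun p => (residual ν ℓ t p, noisyObs ℓ t p)) (withNoise ν) :=
  ⟨isGaussian_map ((residual ν ℓ t).prod (noisyObs ℓ t))⟩

lemma obsVar_eq : obsVar ν ℓ t = Var[ℓ; ν] + t ^ 2 := by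
  have hsnd : MemLp (fun p : E × ℝ => p.2) 2 (withNoise ν) :=
    IsGaussian.memLp_dual (withNoise ν) (ContinuousLinearMap.snd ℝ E ℝ) 2 (by simp)
  have hind : IndepFun (fun p : E × ℝ => ℓ p.1) (fun p : E × ℝ => t * p.2) (withNoise ν) :=
    (indepFun_prod (X := fun f : E => ℓ f) (Y := fun u : ℝ => t * u)
      ℓ.continuous.measurable (by fun_prop))
  have hZ : (noisyObs ℓ t : E × ℝ → ℝ) = (fun p => ℓ p.1) + fun p => t * p.2 := rfl
  rw [obsVar, hZ, hind.variance_add (memLp_comp_fst ν ℓ) (hsnd.const_mul t), variance_const_mul]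
  have h1 := variance_map (μ := withNoise ν) (X := ℓ) (Y := Prod.fst) (by fun_prop) (by fun_prop)
  have h2 := variance_map (μ := withNoise ν) (X := fun u : ℝ => u) (Y := Prod.snd) (by fun_prop)
    (by fun_prop)
  simp only [Measure.map_fst_prod, measure_univ, one_smul, Measure.map_snd_prod] at h1 h2
  rw [h1]
  change _ + t ^ 2 * Var[(fun u : ℝ => u) ∘ Prod.snd; withNoise ν] = _
  rw [← h2, variance_fun_id_gaussianReal]
  simp [Function.comp_def]

variable [CompleteSpace E] [SecondCountableTopology E]

lemma memLp_fst : MemLp (fun p : E × ℝ => p.1) 2 (withNoise ν) := by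
  have h : MemLp (fun f : E => f) 2 ν := IsGaussian.memLp_two_fun_id
  exact h.comp_fst (gaussianReal 0 1)

lemma apply_crossCov (L : StrongDual ℝ E) :
    L (crossCov ν ℓ t) = cov[fun p : E × ℝ => L p.1, noisyObs ℓ t; withNoise ν] := by
  have hc : MemLp (fun p => noisyObs ℓ t p - ∫ q, noisyObs ℓ t q ∂withNoise ν) 2 (withNoise ν) :=
    (memLp_noisyObs ν ℓ t).sub (memLp_const _)
  have hi : Integrable (fun p : E × ℝ =>
      (noisyObs ℓ t p - ∫ q, noisyObs ℓ t q ∂withNoise ν) • p.1) (withNoise ν) :=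
    memLp_one_iff_integrable.1 ((memLp_fst ν).smul hc)
  rw [crossCov, ← L.integral_comp_comm hi, covariance_comm,
    covariance_eq_sub (memLp_noisyObs ν ℓ t) (memLp_comp_fst ν L)]
  simp only [map_smul, smul_eq_mul, sub_mul]
  have h1 : Integrable (fun p => noisyObs ℓ t p * L p.1) (withNoise ν) :=
    (memLp_noisyObs ν ℓ t).integrable_mul (memLp_comp_fst ν L)
  have h2 := (memLp_comp_fst ν L).integrable (by simp)
  rw [integral_sub h1 (h2.const_mul _), integral_const_mul]
  rfl

/-- The noise being independent of the unknown, it does not contribute to the covariance. -/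
lemma apply_crossCov_eq_covariance (L : StrongDual ℝ E) :
    L (crossCov ν ℓ t) = cov[L, ℓ; ν] := by
  have hsnd : MemLp (fun p : E × ℝ => p.2) 2 (withNoise ν) :=
    IsGaussian.memLp_dual (withNoise ν) (ContinuousLinearMap.snd ℝ E ℝ) 2 (by simp)
  have hind : IndepFun (fun p : E × ℝ => L p.1) (fun p : E × ℝ => t * p.2) (withNoise ν) :=
    (indepFun_prod (X := fun f : E => L f) (Y := fun u : ℝ => t * u)
      L.continuous.measurable (by fun_prop))
  have hZ : (noisyObs ℓ t : E × ℝ → ℝ) = (fun p => ℓ p.1) + fun p => t * p.2 := rfl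
  rw [apply_crossCov, hZ, covariance_add_right (memLp_comp_fst ν L) (memLp_comp_fst ν ℓ)
    (hsnd.const_mul t), hind.covariance_eq_zero (memLp_comp_fst ν L) (hsnd.const_mul t), add_zero]
  have := covariance_map_fun (μ := withNoise ν) (X := L) (Y := ℓ) (Z := Prod.fst)
    (by fun_prop) (by fun_prop) (by fun_prop)
  rw [← this]
  simp

/-- A deterministic observation is uncorrelated with everything. -/
lemma apply_crossCov_of_obsVar_eq_zero (hV : obsVar ν ℓ t = 0) (L : StrongDual ℝ E) :
    L (crossCov ν ℓ t) = 0 := by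
  have h1 : noisyObs ℓ t =ᵐ[withNoise ν] fun _ => (withNoise ν)[noisyObs ℓ t] :=
    ae_eq_integral_of_variance_eq_zero (memLp_noisyObs ν ℓ t) hV
  rw [apply_crossCov, covariance]
  refine integral_eq_zero_of_ae ?_
  filter_upwards [h1] with p hp
  rw [hp]; simp

/-- The residual is jointly Gaussian with the observation and uncorrelated with it. -/
lemma indepFun_residual_noisyObs :
    IndepFun (residual ν ℓ t) (noisyObs ℓ t) (withNoise ν) := by
  refine (hasGaussianLaw_residual_noisyObs ν ℓ t).indepFun_of_covariance_strongDual
    fun L₁ L₂ => ?_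
  have hZ := memLp_noisyObs ν ℓ t
  have e₂ : L₂ ∘ noisyObs ℓ t = fun p => L₂ 1 * noisyObs ℓ t p := by
    ext p
    have : noisyObs ℓ t p = noisyObs ℓ t p • (1 : ℝ) := by simp
    simp only [Function.comp_apply]
    rw [this, map_smul]; simp [mul_comm]
  have e₁ : L₁ ∘ residual ν ℓ t = (fun p : E × ℝ => L₁ p.1) - fun p =>
      L₁ (regression ν ℓ t) * noisyObs ℓ t p := by
    ext p
    simp [residual_apply, mul_comm]
  rw [e₁, e₂, covariance_const_mul_right, covariance_sub_left (memLp_comp_fst ν L₁)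
    (hZ.const_mul _) hZ, covariance_const_mul_left, ← apply_crossCov,
    covariance_self hZ.1.aemeasurable]
  change L₂ 1 * (_ - _ * obsVar ν ℓ t) = 0
  rw [regression, map_smul, smul_eq_mul]
  by_cases hV : obsVar ν ℓ t = 0
  · simp [apply_crossCov_of_obsVar_eq_zero ν ℓ t hV L₁, hV]
  · field_simp; ring

/-- Conditioning formula: given `ℓ f + t u = z`, the unknown `f` is distributed as its residual,
translated by `z` times the regression coefficient. -/
lemma condDistrib_noisyObs_ae_eq :
    ∀ᵐ z ∂(withNoise ν).map (noisyObs ℓ t),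
      condDistrib (fun p : E × ℝ => p.1) (noisyObs ℓ t) (withNoise ν) z =
        ((withNoise ν).map (residual ν ℓ t)).map fun f => f + z • regression ν ℓ t := by
  set c := regression ν ℓ t
  set Q := (withNoise ν).map (residual ν ℓ t)
  have hRm : Measurable (residual ν ℓ t) := (residual ν ℓ t).continuous.measurable
  have hZm : Measurable (noisyObs ℓ t) := (noisyObs ℓ t).continuous.measurable
  have : IsProbabilityMeasure Q := Measure.isProbabilityMeasure_map hRm.aemeasurable
  have hg : Measurable fun q : ℝ × E => q.2 + q.1 • c := by fun_prop
  let κ : Kernel ℝ E := (Kernel.id ×ₖ Kernel.const ℝ Q).map fun q => q.2 + q.1 • c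
  have hκ : ∀ z, κ z = Q.map fun f => f + z • c := by
    intro z
    rw [Kernel.map_apply _ hg, Kernel.prod_apply, Kernel.id_apply, Kernel.const_apply,
      Measure.dirac_prod, Measure.map_map hg (by fun_prop)]
    rfl
  have : IsMarkovKernel κ := Kernel.IsMarkovKernel.map _ hg
  have key : (withNoise ν).map (fun p => (noisyObs ℓ t p, p.1))
      = (withNoise ν).map (noisyObs ℓ t) ⊗ₘ κ := by
    refine Measure.ext_of_lintegral _ fun g hgm => ?_
    rw [Measure.lintegral_compProd hgm, lintegral_map hgm (by fun_prop)]
    have h1 : ∀ z, ∫⁻ f, g (z, f) ∂κ z = ∫⁻ f, g (z, f + z • c) ∂Q := fun z => by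
      rw [hκ, lintegral_map (by fun_prop) (by fun_prop)]
    simp_rw [h1]
    have hgm' : Measurable fun q : ℝ × E => g (q.1, q.2 + q.1 • c) := by fun_prop
    have hprod := (indepFun_iff_map_prod_eq_prod_map_map hZm.aemeasurable hRm.aemeasurable).1
      (indepFun_residual_noisyObs ν ℓ t).symm
    rw [← lintegral_prod _ hgm'.aemeasurable, ← hprod, lintegral_map hgm' (by fun_prop)]
    refine lintegral_congr fun p => ?_
    rw [residual_add]
  filter_upwards [condDistrib_ae_eq_of_measure_eq_compProd (noisyObs ℓ t) (by fun_prop) key]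
    with z hz
  rw [hz, hκ]

end Conditioning

/-! ### The knowledge gradient of a Gaussian measure -/

section Excess

/-- The mean excess over `A` of a centered normal variable with standard deviation `s`. -/
noncomputable def posExcess (A s : ℝ) : ℝ := ∫ w, max 0 (s * w - A) ∂gaussianReal 0 1

lemma integrable_max_zero_affine (A s : ℝ) :
    Integrable (fun w => max 0 (s * w - A)) (gaussianReal 0 1) := by
  have h : Integrable (fun w : ℝ => w) (gaussianReal 0 1) := IsGaussian.integrable_fun_id
  have h2 : Integrable (fun w : ℝ => s * w - A) (gaussianReal 0 1) :=
    (h.const_mul s).sub (integrable_const A)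
  exact h2.pos_part.congr (ae_of_all _ fun w => max_comm _ _)

lemma posExcess_pos {A s : ℝ} (hs : 0 < s) : 0 < posExcess A s := by
  rw [posExcess, integral_pos_iff_support_of_nonneg (f := fun w => max 0 (s * w - A))
    (fun w => le_max_left _ _) (integrable_max_zero_affine A s)]
  have hsub : Set.Ioo (A / s) (A / s + 1) ⊆ Function.support fun w => max 0 (s * w - A) := by
    intro w hw
    have : 0 < s * w - A := by
      have := (div_lt_iff₀ hs).1 hw.1
      linarith
    simp only [Function.mem_support]
    exact (lt_max_of_lt_right this).ne'
  refine lt_of_lt_of_le ?_ (measure_mono hsub)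
  rw [pos_iff_ne_zero]
  intro h0
  have h1 : (volume : Measure ℝ) (Set.Ioo (A / s) (A / s + 1)) = 0 :=
    gaussianReal_absolutelyContinuous' 0 one_ne_zero h0
  simp at h1

lemma posExcess_mono {A A' s s' : ℝ} (hA : A' ≤ A) (hA0 : 0 ≤ A) (hs0 : 0 ≤ s) (hs : s ≤ s') :
    posExcess A s ≤ posExcess A' s' := by
  refine integral_mono (integrable_max_zero_affine _ _) (integrable_max_zero_affine _ _)
    fun w => ?_
  refine max_le (le_max_left _ _) ?_
  rcases le_total 0 w with hw | hw
  · refine le_max_of_le_right ?_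
    have := mul_le_mul_of_nonneg_right hs hw
    linarith
  · refine le_max_of_le_left ?_
    have := mul_nonpos_of_nonneg_of_nonpos hs0 hw
    linarith

/-- The law of `a + b z`, for `z` normal, depends on `b` through `|b|` only. -/
lemma integral_max_zero_gaussianReal (m a b : ℝ) (V : NNReal) :
    ∫ z, max 0 (a + b * z) ∂gaussianReal m V = posExcess (-(a + b * m)) (|b| * √V) := by
  have hmax : Continuous fun y : ℝ => max 0 y := by fun_prop
  have h1 : (gaussianReal m V).map (fun z => a + b * z)
      = (gaussianReal 0 1).map fun w => |b| * √V * w - -(a + b * m) := by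
    have e1 : (fun z => a + b * z) = (fun y => a + y) ∘ fun z => b * z := rfl
    have e2 : (fun w => |b| * √V * w - -(a + b * m))
        = (fun y => y - -(a + b * m)) ∘ fun w => |b| * √V * w := rfl
    rw [e1, e2, ← Measure.map_map (by fun_prop) (by fun_prop),
      ← Measure.map_map (by fun_prop) (by fun_prop), gaussianReal_map_const_mul,
      gaussianReal_map_const_add, gaussianReal_map_const_mul, gaussianReal_map_sub_const]
    congr 1
    · ring
    · refine NNReal.coe_injective ?_
      simp [mul_pow]
  have h2 := integral_map (μ := gaussianReal m V) (φ := fun z => a + b * z)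
    (by fun_prop) hmax.aestronglyMeasurable
  rw [posExcess, ← h2, h1, integral_map (by fun_prop) hmax.aestronglyMeasurable]

end Excess

section KnowledgeGradient

variable {𝕏 : Type*} [MetricSpace 𝕏] [CompactSpace 𝕏]

/-- Evaluation at `x`, as a continuous linear functional on `C(𝕏, ℝ)`. -/
noncomputable abbrev evalAt (x : 𝕏) : StrongDual ℝ C(𝕏, ℝ) := ContinuousMap.evalCLM ℝ x

/-- The expected increase of the maximum of the mean function after one observation at `x`. -/
noncomputable def knowledgeGain (τ : 𝕏 → ℝ) (x : 𝕏) (ν : Measure C(𝕏, ℝ)) [IsFiniteMeasure ν] :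
    ℝ :=
  (∫ p : C(𝕏, ℝ) × ℝ, ⨆ u, meanFun (condAt τ x ν (p.1 x + τ x * p.2)) u ∂withNoise ν)
    - ⨆ u, meanFun ν u

section General

variable (τ : 𝕏 → ℝ) (x : 𝕏) (ν : Measure C(𝕏, ℝ))

lemma measurable_obsMap : Measurable fun p : C(𝕏, ℝ) × ℝ => p.1 x + τ x * p.2 :=
  (noisyObs (evalAt x) (τ x)).continuous.measurable

lemma integrable_map_obs_fst
    (hν : Integrable (fun f : C(𝕏, ℝ) => f) ν) :
    Integrable (fun q : ℝ × C(𝕏, ℝ) => q.2)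
      ((withNoise ν).map fun p => (p.1 x + τ x * p.2, p.1)) := by
  rw [integrable_map_measure (by fun_prop)
    ((measurable_obsMap τ x).prodMk measurable_fst).aemeasurable]
  exact hν.comp_fst (gaussianReal 0 1)

lemma exists_meanFun_argmax [Nonempty 𝕏] (hν : Integrable (fun f : C(𝕏, ℝ) => f) ν) :
    ∃ v, ∀ u, meanFun ν u ≤ meanFun ν v := by
  obtain ⟨v, -, hv⟩ := isCompact_univ.exists_isMaxOn (Set.univ_nonempty (α := 𝕏))
    (∫ f, f ∂ν : C(𝕏, ℝ)).continuous.continuousOn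
  refine ⟨v, fun u => ?_⟩
  rw [meanFun_eq hν, meanFun_eq hν]
  exact hv (Set.mem_univ u)

variable [IsProbabilityMeasure ν]

lemma integrable_condAt
    (hν : Integrable (fun f : C(𝕏, ℝ) => f) ν) :
    ∀ᵐ p ∂withNoise ν, Integrable (fun f : C(𝕏, ℝ) => f) (condAt τ x ν (p.1 x + τ x * p.2)) :=
  (integrable_map_obs_fst τ x ν hν).condDistrib_ae (measurable_obsMap τ x).aemeasurable
    (by fun_prop)

lemma integrable_sup_meanFun_condAt [Nonempty 𝕏]
    (hν : Integrable (fun f : C(𝕏, ℝ) => f) ν) :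
    Integrable (fun p : C(𝕏, ℝ) × ℝ => ⨆ u, meanFun (condAt τ x ν (p.1 x + τ x * p.2)) u)
      (withNoise ν) := by
  have h1 : Integrable (fun p : C(𝕏, ℝ) × ℝ => ∫ f, f ∂condAt τ x ν (p.1 x + τ x * p.2))
      (withNoise ν) :=
    (integrable_map_obs_fst τ x ν hν).integral_condDistrib (measurable_obsMap τ x).aemeasurable
      (by fun_prop)
  refine (integrable_sup h1).congr ?_
  filter_upwards [integrable_condAt τ x ν hν] with p hp
  simp_rw [meanFun_eq hp]

/-- The expected decrease of the uncertainty functional is the expected increase of the maximum of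
the mean function, because the expected maximum of the paths is unchanged on average. -/
lemma kgUncertainty_sub_expectedResidual [Nonempty 𝕏]
    (hν : Integrable (fun f : C(𝕏, ℝ) => f) ν) :
    kgUncertainty ν - expectedResidual τ x ν = knowledgeGain τ x ν := by
  have hZ := measurable_obsMap τ x
  have hs : StronglyMeasurable fun f : C(𝕏, ℝ) => ⨆ u, f u := continuous_sup.stronglyMeasurable
  have hint : Integrable (fun p : C(𝕏, ℝ) × ℝ => ⨆ u, p.1 u) (withNoise ν) :=
    (integrable_sup hν).comp_fst (gaussianReal 0 1)
  have h1 := condExp_ae_eq_integral_condDistrib (μ := withNoise ν) hZ measurable_fst.aemeasurable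
    hs hint
  have h2 : ∫ p : C(𝕏, ℝ) × ℝ, (∫ f, ⨆ u, f u ∂condAt τ x ν (p.1 x + τ x * p.2)) ∂withNoise ν
      = ∫ f, ⨆ u, f u ∂ν := by
    have h3 := integral_congr_ae h1
    rw [integral_condExp hZ.comap_le] at h3
    refine h3.symm.trans ?_
    have := integral_map (μ := withNoise ν) (φ := Prod.fst) (f := fun f : C(𝕏, ℝ) => ⨆ u, f u)
      (by fun_prop) continuous_sup.aestronglyMeasurable
    rw [← this]
    simp
  have h4 : Integrable (fun p : C(𝕏, ℝ) × ℝ => ∫ f, ⨆ u, f u ∂condAt τ x ν (p.1 x + τ x * p.2))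
      (withNoise ν) := integrable_condExp.congr h1
  unfold expectedResidual kgUncertainty knowledgeGain
  rw [integral_sub h4 (integrable_sup_meanFun_condAt τ x ν hν), h2]
  ring

end General

section Gaussian

variable (τ : 𝕏 → ℝ) (x : 𝕏) (ν : Measure C(𝕏, ℝ)) [IsGaussian ν]

lemma integrable_id_of_isGaussian : Integrable (fun f : C(𝕏, ℝ) => f) ν :=
  IsGaussian.integrable_fun_id

lemma condAt_ae_eq :
    ∀ᵐ z ∂(withNoise ν).map (fun p : C(𝕏, ℝ) × ℝ => p.1 x + τ x * p.2),
      condAt τ x ν z = ((withNoise ν).map (residual ν (evalAt x) (τ x))).map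
        fun f => f + z • regression ν (evalAt x) (τ x) :=
  condDistrib_noisyObs_ae_eq ν (evalAt x) (τ x)

/-- Conditioning on a noisy evaluation preserves Gaussianity. -/
lemma isGaussian_condAt :
    ∀ᵐ z ∂(withNoise ν).map (fun p : C(𝕏, ℝ) × ℝ => p.1 x + τ x * p.2),
      IsGaussian (condAt τ x ν z) := by
  filter_upwards [condAt_ae_eq τ x ν] with z hz
  rw [hz]
  infer_instance

lemma integrable_residual :
    Integrable (residual ν (evalAt x) (τ x)) (withNoise ν) :=
  (hasGaussianLaw_residual_noisyObs ν (evalAt x) (τ x)).fst.integrable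

lemma meanFun_condAt_ae_eq :
    ∀ᵐ p ∂withNoise ν, ∀ u, meanFun (condAt τ x ν (p.1 x + τ x * p.2)) u =
      (∫ q, residual ν (evalAt x) (τ x) q ∂withNoise ν) u
        + (p.1 x + τ x * p.2) * regression ν (evalAt x) (τ x) u := by
  filter_upwards [ae_of_ae_map (measurable_obsMap τ x).aemeasurable (condAt_ae_eq τ x ν)]
    with p hp u
  have hR : AEMeasurable (residual ν (evalAt x) (τ x)) (withNoise ν) := by fun_prop
  have hi := integrable_residual τ x ν
  rw [meanFun, hp, integral_map (by fun_prop)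
    (continuous_eval_const (F := C(𝕏, ℝ)) u).aestronglyMeasurable, integral_map hR (by
      refine Continuous.aestronglyMeasurable ?_
      exact (continuous_eval_const (F := C(𝕏, ℝ)) u).comp (by fun_prop))]
  simp only [ContinuousMap.add_apply, ContinuousMap.smul_apply, smul_eq_mul]
  have h1 : Integrable (fun q => residual ν (evalAt x) (τ x) q u) (withNoise ν) :=
    (evalAt u).integrable_comp hi
  rw [integral_add h1 (integrable_const _)]
  congr 1
  · exact (evalAt u).integral_comp_comm hi
  · simp

/-- The mean function is the mean of the residual plus the regression on the mean observation. -/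
lemma meanFun_eq_residual_add (u : 𝕏) :
    meanFun ν u = (∫ q, residual ν (evalAt x) (τ x) q ∂withNoise ν) u
      + (∫ p : C(𝕏, ℝ) × ℝ, p.1 x + τ x * p.2 ∂withNoise ν)
        * regression ν (evalAt x) (τ x) u := by
  have hi := integrable_residual τ x ν
  have hZ : Integrable (fun p : C(𝕏, ℝ) × ℝ => p.1 x + τ x * p.2) (withNoise ν) :=
    (memLp_noisyObs ν (evalAt x) (τ x)).integrable (by simp)
  have h1 : Integrable (fun q => residual ν (evalAt x) (τ x) q u) (withNoise ν) :=
    (evalAt u).integrable_comp hi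
  have h2 : (∫ q, residual ν (evalAt x) (τ x) q ∂withNoise ν) u
      = ∫ q, residual ν (evalAt x) (τ x) q u ∂withNoise ν :=
    ((evalAt u).integral_comp_comm hi).symm
  rw [h2, ← integral_mul_const, ← integral_add h1 (hZ.mul_const _)]
  have h3 := integral_map (μ := withNoise ν) (φ := Prod.fst) (f := fun f : C(𝕏, ℝ) => f u)
    (by fun_prop) (continuous_eval_const (F := C(𝕏, ℝ)) u).aestronglyMeasurable
  simp only [Measure.map_fst_prod, measure_univ, one_smul] at h3
  rw [meanFun, h3]
  refine integral_congr_ae (ae_of_all _ fun p => ?_)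
  have := congrArg (fun f : C(𝕏, ℝ) => f u) (residual_add ν (evalAt x) (τ x) p)
  exact this.symm

/-- The standard deviation of `L` applied to the conditional mean, which moves along the regression
coefficient as the observation varies. Both sides are `0` if the observation is deterministic. -/
lemma abs_regression_mul_sqrt (L : StrongDual ℝ C(𝕏, ℝ)) :
    |L (regression ν (evalAt x) (τ x))| * √(obsVar ν (evalAt x) (τ x))
      = |cov[L, evalAt x; ν]| / √(obsVar ν (evalAt x) (τ x)) := by
  have hV : 0 ≤ obsVar ν (evalAt x) (τ x) := variance_nonneg _ _
  rw [regression, map_smul, apply_crossCov_eq_covariance, smul_eq_mul, abs_mul,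
    abs_of_nonneg (inv_nonneg.2 hV)]
  have := Real.mul_self_sqrt hV
  rcases hV.eq_or_lt with h0 | hpos
  · simp [← h0]
  · have hs := Real.sqrt_pos.2 hpos
    nth_rewrite 1 [← this]
    field_simp

/-- The gain of an observation at `x` is at least the mean positive part of the (Gaussian)
posterior mean difference between `u` and a maximizer `v` of the prior mean. -/
lemma posExcess_le_knowledgeGain [Nonempty 𝕏] {v : 𝕏} (hv : ∀ u, meanFun ν u ≤ meanFun ν v)
    (u : 𝕏) :
    posExcess (meanFun ν v - meanFun ν u)
      (|cov[evalAt u - evalAt v, evalAt x; ν]| / √(obsVar ν (evalAt x) (τ x)))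
      ≤ knowledgeGain τ x ν := by
  set r := ∫ q, residual ν (evalAt x) (τ x) q ∂withNoise ν with hr
  set c := regression ν (evalAt x) (τ x) with hc
  set V := obsVar ν (evalAt x) (τ x) with hVdef
  set Z : C(𝕏, ℝ) × ℝ → ℝ := fun p => p.1 x + τ x * p.2 with hZdef
  have hV : 0 ≤ V := variance_nonneg _ _
  have hZint : Integrable Z (withNoise ν) :=
    (memLp_noisyObs ν (evalAt x) (τ x)).integrable (by simp)
  have hZm : Measurable Z := measurable_obsMap τ x
  have hlaw : (withNoise ν).map Z = gaussianReal (∫ p, Z p ∂withNoise ν) V.toNNReal :=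
    IsGaussian.map_eq_gaussianReal (μ := withNoise ν) (noisyObs (evalAt x) (τ x))
  have hm : ∀ w, meanFun ν w = r w + (∫ p, Z p ∂withNoise ν) * c w :=
    meanFun_eq_residual_add τ x ν
  have hsup : (⨆ w, meanFun ν w) ≤ meanFun ν v := ciSup_le hv
  have hmax : Continuous fun z : ℝ => max 0 ((r u - r v) + (c u - c v) * z) := by fun_prop
  have hexc : ∫ p, max 0 ((r u - r v) + (c u - c v) * Z p) ∂withNoise ν
      = posExcess (meanFun ν v - meanFun ν u)
        (|cov[evalAt u - evalAt v, evalAt x; ν]| / √V) := by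
    rw [← integral_map hZm.aemeasurable (f := fun z => max 0 ((r u - r v) + (c u - c v) * z))
      hmax.aestronglyMeasurable, hlaw, integral_max_zero_gaussianReal, hm u, hm v,
      Real.coe_toNNReal _ hV, hVdef, ← abs_regression_mul_sqrt]
    congr 1
    ring
  have hlin : Integrable (fun p => (r u - r v) + (c u - c v) * Z p) (withNoise ν) :=
    (integrable_const _).add (hZint.const_mul _)
  have hposint : Integrable (fun p => max 0 ((r u - r v) + (c u - c v) * Z p)) (withNoise ν) :=
    hlin.pos_part.congr (ae_of_all _ fun p => max_comm _ _)
  have hvint : Integrable (fun p => r v + Z p * c v) (withNoise ν) :=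
    (integrable_const _).add (hZint.mul_const _)
  have hle : ∫ p, ((r v + Z p * c v) + max 0 ((r u - r v) + (c u - c v) * Z p)) ∂withNoise ν
      ≤ ∫ p, ⨆ w, meanFun (condAt τ x ν (Z p)) w ∂withNoise ν := by
    refine integral_mono_ae (hvint.add hposint)
      (integrable_sup_meanFun_condAt τ x ν (integrable_id_of_isGaussian ν)) ?_
    filter_upwards [meanFun_condAt_ae_eq τ x ν] with p hp
    have hp' : (fun w => meanFun (condAt τ x ν (Z p)) w) = ⇑(r + Z p • c) := funext hp
    change _ ≤ ⨆ w, meanFun (condAt τ x ν (Z p)) w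
    rw [hp']
    have h1 := le_sup (r + Z p • c) v
    have h2 := le_sup (r + Z p • c) u
    simp only [ContinuousMap.add_apply, ContinuousMap.smul_apply, smul_eq_mul] at h1 h2
    change _ ≤ ⨆ w, (r + Z p • c) w
    rcases max_cases 0 ((r u - r v) + (c u - c v) * Z p) with ⟨h, -⟩ | ⟨h, -⟩ <;> rw [h] <;>
      simp only [ContinuousMap.add_apply, ContinuousMap.smul_apply, smul_eq_mul] <;> linarith
  rw [integral_add hvint hposint, hexc, integral_add (integrable_const _) (hZint.mul_const _),
    integral_mul_const] at hle
  simp only [integral_const, probReal_univ, one_smul] at hle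
  rw [← hm v] at hle
  unfold knowledgeGain
  linarith

lemma knowledgeGain_nonneg [Nonempty 𝕏] : 0 ≤ knowledgeGain τ x ν := by
  obtain ⟨v, hv⟩ := exists_meanFun_argmax ν (integrable_id_of_isGaussian ν)
  exact (integral_nonneg fun w => le_max_left _ _).trans (posExcess_le_knowledgeGain τ x ν hv v)

/-- If every observation has a gain at most `δ`, then the variance of `f u - f v`, for `v` a
maximizer of the mean, cannot exceed a threshold `ε` unless `δ` exceeds a positive quantity that
depends only on `ε` and on moment bounds. Indeed
`Var (f u - f v) = cov (f u - f v, f u) - cov (f u - f v, f v)`,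
so one of these two covariances, hence the gain at `u` or at `v`, is not small. -/
lemma posExcess_le_of_variance_ge [Nonempty 𝕏] {v u : 𝕏}
    (hv : ∀ u, meanFun ν u ≤ meanFun ν v) {B₁ B₂ T δ ε : ℝ} (hB₁ : ∫ f, ‖f‖ ∂ν ≤ B₁)
    (hB₂ : ∫ f, ‖f‖ ^ 2 ∂ν ≤ B₂) (hT : ∀ x, τ x ^ 2 ≤ T) (hδ : ∀ x, knowledgeGain τ x ν ≤ δ)
    (hε : 0 < ε) (hvar : ε ≤ Var[fun f : C(𝕏, ℝ) => f u - f v; ν]) :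
    posExcess (2 * B₁) (ε / 2 / √(B₂ + T)) ≤ δ := by
  have hid := integrable_id_of_isGaussian ν
  have hmem : ∀ L : StrongDual ℝ C(𝕏, ℝ), MemLp L 2 ν := fun L =>
    IsGaussian.memLp_dual ν L 2 (by simp)
  have hmean : ∀ w, |meanFun ν w| ≤ B₁ := fun w => by
    refine le_trans ?_ hB₁
    refine abs_integral_le_integral_abs.trans ?_
    exact integral_mono ((evalAt w).integrable_comp hid).abs hid.norm
      fun f => f.norm_coe_le_norm w
  have hB₁0 : 0 ≤ B₁ := (abs_nonneg _).trans (hmean v)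
  have hmdiff : meanFun ν v - meanFun ν u ≤ 2 * B₁ := by
    have h1 := abs_le.1 (hmean v)
    have h2 := abs_le.1 (hmean u)
    linarith
  have hnorm2 : Integrable (fun f : C(𝕏, ℝ) => ‖f‖ ^ 2) ν := by
    have h : MemLp (fun f : C(𝕏, ℝ) => f) 2 ν := IsGaussian.memLp_two_fun_id
    exact h.integrable_norm_pow (by norm_num)
  have hVle : ∀ x, obsVar ν (evalAt x) (τ x) ≤ B₂ + T := fun x => by
    rw [obsVar_eq]
    refine add_le_add ?_ (hT x)
    refine (variance_le_expectation_sq (hmem (evalAt x)).1).trans (le_trans ?_ hB₂)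
    refine integral_mono (hmem (evalAt x)).integrable_sq hnorm2 fun f => ?_
    have := f.norm_coe_le_norm x
    simp only [Pi.pow_apply]
    exact (sq_abs (f x)).symm.le.trans (pow_le_pow_left₀ (abs_nonneg _) this 2)
  -- a point whose value is substantially correlated with `f u - f v`
  obtain ⟨x, hx⟩ : ∃ x, ε / 2 ≤ |cov[evalAt u - evalAt v, evalAt x; ν]| := by
    by_contra! h
    have e : Var[fun f : C(𝕏, ℝ) => f u - f v; ν] = cov[evalAt u - evalAt v, evalAt u; ν]
        - cov[evalAt u - evalAt v, evalAt v; ν] := by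
      rw [← covariance_sub_right (hmem _) (hmem _) (hmem _)]
      exact (covariance_self (hmem (evalAt u - evalAt v)).1.aemeasurable).symm
    have h1 := abs_lt.1 (h u)
    have h2 := abs_lt.1 (h v)
    linarith
  have hVpos : 0 < obsVar ν (evalAt x) (τ x) := by
    refine lt_of_le_of_ne (variance_nonneg _ _) fun h0 => ?_
    have h1 := apply_crossCov_of_obsVar_eq_zero ν (evalAt x) (τ x) h0.symm (evalAt u - evalAt v)
    rw [apply_crossCov_eq_covariance] at h1
    rw [h1, abs_zero] at hx
    linarith
  refine le_trans (posExcess_mono hmdiff (by positivity) (by positivity) ?_)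
    ((posExcess_le_knowledgeGain τ x ν hv u).trans (hδ x))
  exact div_le_div₀ (abs_nonneg _) hx (Real.sqrt_pos.2 hVpos) (Real.sqrt_le_sqrt (hVle x))

end Gaussian

end KnowledgeGradient

/-! ### Recursive structure of the posteriors -/

section Update

variable {𝕏 H : Type*} [MetricSpace 𝕏] [MeasurableSpace H]

/-- The kernel giving the joint law of the unknown and the noise, given the past. -/
noncomputable abbrev noiseKernel (κ : Kernel H C(𝕏, ℝ)) : Kernel H (C(𝕏, ℝ) × ℝ) :=
  κ ×ₖ Kernel.const H (gaussianReal 0 1)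

lemma noiseKernel_apply (κ : Kernel H C(𝕏, ℝ)) [IsSFiniteKernel κ] (h : H) :
    noiseKernel κ h = withNoise (κ h) := by
  rw [noiseKernel, Kernel.prod_apply, Kernel.const_apply]

variable [CompactSpace 𝕏] [MeasurableSpace 𝕏] [BorelSpace 𝕏]

/-- The observation as a function of the past, the unknown and the noise, when the design point is
`x h` after the past `h`. -/
def pastObs (τ : 𝕏 → ℝ) (x : H → 𝕏) (q : H × C(𝕏, ℝ) × ℝ) : ℝ :=
  q.2.1 (x q.1) + τ (x q.1) * q.2.2

lemma measurable_pastObs {τ : 𝕏 → ℝ} (hτ : Continuous τ) {x : H → 𝕏} (hx : Measurable x) :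
    Measurable (pastObs τ x : H × C(𝕏, ℝ) × ℝ → ℝ) := by
  have hev : Measurable fun p : C(𝕏, ℝ) × 𝕏 => p.1 p.2 := continuous_eval.measurable
  have h1 : Measurable fun q : H × C(𝕏, ℝ) × ℝ => q.2.1 (x q.1) :=
    hev.comp ((measurable_fst.comp measurable_snd).prodMk (hx.comp measurable_fst))
  have h2 : Measurable fun q : H × C(𝕏, ℝ) × ℝ => τ (x q.1) :=
    hτ.measurable.comp (hx.comp measurable_fst)
  exact h1.add (h2.mul (measurable_snd.comp measurable_snd))

variable (τ : 𝕏 → ℝ) (x : H → 𝕏) (κ : Kernel H C(𝕏, ℝ)) [IsMarkovKernel κ]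

/-- The regression coefficient is a quotient of parametric integrals over the past. -/
lemma measurable_regression (hτ : Continuous τ) (hx : Measurable x) :
    Measurable fun h => regression (κ h) (evalAt (x h)) (τ (x h)) := by
  have hg := measurable_pastObs hτ hx
  have hmean : StronglyMeasurable fun h => ∫ p, pastObs τ x (h, p) ∂noiseKernel κ h :=
    hg.stronglyMeasurable.integral_kernel_prod_right'
  have hc : Measurable fun q : H × C(𝕏, ℝ) × ℝ =>
      pastObs τ x q - ∫ p, pastObs τ x (q.1, p) ∂noiseKernel κ q.1 :=
    hg.sub (hmean.measurable.comp measurable_fst)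
  have hvar : StronglyMeasurable fun h => ∫ p, (pastObs τ x (h, p)
      - ∫ p, pastObs τ x (h, p) ∂noiseKernel κ h) ^ 2 ∂noiseKernel κ h :=
    (hc.pow_const 2).stronglyMeasurable.integral_kernel_prod_right'
  have hcov : StronglyMeasurable fun h => ∫ p, (pastObs τ x (h, p)
      - ∫ p, pastObs τ x (h, p) ∂noiseKernel κ h) • p.1 ∂noiseKernel κ h :=
    (hc.smul (measurable_fst.comp measurable_snd)).stronglyMeasurable.integral_kernel_prod_right'
  convert hvar.measurable.inv.smul hcov.measurable using 1
  funext h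
  simp only [regression, obsVar, crossCov, noiseKernel_apply, Pi.smul_apply', Pi.inv_apply]
  rw [variance_eq_integral (noisyObs (evalAt (x h)) (τ (x h))).continuous.measurable.aemeasurable]
  rfl

/-- The posterior after one observation `z` at `x h`, as a kernel jointly in the past `h` and the
observation `z`. -/
noncomputable def updateKernel : Kernel (H × ℝ) C(𝕏, ℝ) :=
  (Kernel.id ×ₖ (noiseKernel κ).comap Prod.fst measurable_fst).map fun q =>
    residual (κ q.1.1) (evalAt (x q.1.1)) (τ (x q.1.1)) q.2
      + q.1.2 • regression (κ q.1.1) (evalAt (x q.1.1)) (τ (x q.1.1))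

lemma measurable_update (hτ : Continuous τ) (hx : Measurable x) :
    Measurable fun q : (H × ℝ) × C(𝕏, ℝ) × ℝ =>
      residual (κ q.1.1) (evalAt (x q.1.1)) (τ (x q.1.1)) q.2
        + q.1.2 • regression (κ q.1.1) (evalAt (x q.1.1)) (τ (x q.1.1)) := by
  have hr : Measurable fun q : (H × ℝ) × C(𝕏, ℝ) × ℝ =>
      regression (κ q.1.1) (evalAt (x q.1.1)) (τ (x q.1.1)) :=
    (measurable_regression τ x κ hτ hx).comp (measurable_fst.comp measurable_fst)
  have hg : Measurable fun q : (H × ℝ) × C(𝕏, ℝ) × ℝ => pastObs τ x (q.1.1, q.2) :=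
    (measurable_pastObs hτ hx).comp ((measurable_fst.comp measurable_fst).prodMk measurable_snd)
  have h1 : Measurable fun q : (H × ℝ) × C(𝕏, ℝ) × ℝ => q.1.2 :=
    measurable_snd.comp measurable_fst
  exact ((measurable_fst.comp measurable_snd).sub (hg.smul hr)).add (h1.smul hr)

lemma updateKernel_apply (hτ : Continuous τ) (hx : Measurable x) (q : H × ℝ) :
    updateKernel τ x κ q =
      ((withNoise (κ q.1)).map (residual (κ q.1) (evalAt (x q.1)) (τ (x q.1)))).map
        fun f => f + q.2 • regression (κ q.1) (evalAt (x q.1)) (τ (x q.1)) := by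
  have hm := measurable_update τ x κ hτ hx
  rw [updateKernel, Kernel.map_apply _ hm, Kernel.prod_apply, Kernel.id_apply, Kernel.comap_apply,
    noiseKernel_apply, Measure.dirac_prod, Measure.map_map hm (by fun_prop),
    Measure.map_map (by fun_prop) (by fun_prop)]
  rfl

lemma isMarkovKernel_updateKernel (hτ : Continuous τ) (hx : Measurable x) :
    IsMarkovKernel (updateKernel τ x κ) :=
  Kernel.IsMarkovKernel.map _ (measurable_update τ x κ hτ hx)

/-- If the current posteriors are Gaussian, then `updateKernel` disintegrates the joint law of the
past, the new observation and the unknown. -/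
lemma map_pastObs_eq_compProd_updateKernel (hτ : Continuous τ) (hx : Measurable x) {Ω : Type*}
    [MeasurableSpace Ω] (P : Measure Ω) [IsProbabilityMeasure P] {Y : Ω → H} (hY : Measurable Y)
    (hκ : ∀ᵐ ω ∂P, IsGaussian (κ (Y ω))) :
    (P.map Y ⊗ₘ noiseKernel κ).map (fun q => ((q.1, pastObs τ x q), q.2.1)) =
      (P.map Y ⊗ₘ noiseKernel κ).map (fun q => (q.1, pastObs τ x q)) ⊗ₘ updateKernel τ x κ := by
  have := isMarkovKernel_updateKernel τ x κ hτ hx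
  have := Measure.isProbabilityMeasure_map (μ := P) hY.aemeasurable
  have hg := measurable_pastObs hτ hx
  refine Measure.ext_of_lintegral _ fun F hF => ?_
  have hFi : Measurable fun q : H × ℝ => ∫⁻ e, F (q, e) ∂updateKernel τ x κ q :=
    hF.lintegral_kernel_prod_right'
  have hFi' : Measurable fun q : H × C(𝕏, ℝ) × ℝ =>
      ∫⁻ e, F ((q.1, pastObs τ x q), e) ∂updateKernel τ x κ (q.1, pastObs τ x q) :=
    hFi.comp (measurable_fst.prodMk hg)
  have hFg : Measurable fun q : H × C(𝕏, ℝ) × ℝ => F ((q.1, pastObs τ x q), q.2.1) := by fun_prop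
  rw [lintegral_map hF (by fun_prop), Measure.lintegral_compProd hF,
    lintegral_map hFi (by fun_prop), Measure.lintegral_compProd hFg,
    Measure.lintegral_compProd hFi', lintegral_map hFg.lintegral_kernel_prod_right' hY,
    lintegral_map hFi'.lintegral_kernel_prod_right' hY]
  refine lintegral_congr_ae ?_
  filter_upwards [hκ] with ω hω
  generalize Y ω = h at hω
  rw [noiseKernel_apply]
  have hZ := measurable_obsMap τ (x h)
  have hcond := condAt_ae_eq τ (x h) (κ h)
  have hFh : Measurable fun p : ℝ × C(𝕏, ℝ) => F ((h, p.1), p.2) := by fun_prop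
  calc ∫⁻ p, F ((h, pastObs τ x (h, p)), p.1) ∂withNoise (κ h)
      = ∫⁻ q, F ((h, q.1), q.2) ∂(withNoise (κ h)).map
          fun p : C(𝕏, ℝ) × ℝ => (p.1 (x h) + τ (x h) * p.2, p.1) := by
        rw [lintegral_map hFh (hZ.prodMk measurable_fst)]; rfl
    _ = ∫⁻ z, ∫⁻ f, F ((h, z), f) ∂condAt τ (x h) (κ h) z
          ∂(withNoise (κ h)).map fun p : C(𝕏, ℝ) × ℝ => p.1 (x h) + τ (x h) * p.2 := by
        rw [← compProd_map_condDistrib measurable_fst.aemeasurable,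
          Measure.lintegral_compProd hFh]
        rfl
    _ = ∫⁻ z, ∫⁻ f, F ((h, z), f) ∂updateKernel τ x κ (h, z)
          ∂(withNoise (κ h)).map fun p : C(𝕏, ℝ) × ℝ => p.1 (x h) + τ (x h) * p.2 := by
        refine lintegral_congr_ae ?_
        filter_upwards [hcond] with z hz
        rw [hz, updateKernel_apply τ x κ hτ hx]
    _ = _ := lintegral_map (hFi.comp (measurable_const.prodMk measurable_id)) hZ

end Update

/-! ### The observation model -/

section Model

variable {𝕏 Ω : Type*}

/-- The data obtained from `h` by appending one pair (design point, observation). -/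
def appendData {n : ℕ} (h : Fin n → 𝕏 × ℝ) (a : 𝕏 × ℝ) : Fin (n + 1) → 𝕏 × ℝ :=
  Fin.snoc (α := fun _ => 𝕏 × ℝ) h a

lemma measurable_appendData [MeasurableSpace 𝕏] {n : ℕ} :
    Measurable fun q : (Fin n → 𝕏 × ℝ) × (𝕏 × ℝ) => appendData q.1 q.2 := by
  refine measurable_pi_iff.2 fun i => ?_
  refine Fin.lastCases ?_ (fun j => ?_) i
  · simpa [appendData] using measurable_snd
  · simpa [appendData, Function.comp_def] using (measurable_pi_apply j).comp measurable_fst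

lemma measurable_appendData_rule [MeasurableSpace 𝕏] {n : ℕ} {x : (Fin n → 𝕏 × ℝ) → 𝕏}
    (hx : Measurable x) :
    Measurable fun q : (Fin n → 𝕏 × ℝ) × ℝ => appendData q.1 (x q.1, q.2) :=
  measurable_appendData.comp
    (measurable_fst.prodMk ((hx.comp measurable_fst).prodMk measurable_snd))

lemma history_succ [TopologicalSpace 𝕏] (τ : 𝕏 → ℝ) (ξ : Ω → C(𝕏, ℝ)) (U : ℕ → Ω → ℝ)
    (X : ℕ → Ω → 𝕏) (n : ℕ) (ω : Ω) :
    history τ ξ U X (n + 1) ω = appendData (history τ ξ U X n ω) (X n ω, obs τ ξ U X n ω) := by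
  funext i
  refine Fin.lastCases ?_ (fun j => ?_) i
  · simp [appendData, history]
  · simp [appendData, history]

/-- Regrouping of independence: the path can be added to the past noise variables. -/
lemma indepFun_prodMk_of_indepFun [MeasurableSpace Ω] {P : Measure Ω} [IsProbabilityMeasure P]
    {α β γ : Type*} [MeasurableSpace α] [MeasurableSpace β] [MeasurableSpace γ] {A : Ω → α}
    {B : Ω → β} {C : Ω → γ} (hA : Measurable A) (hB : Measurable B) (hC : Measurable C)
    (hABC : IndepFun A (fun ω => (B ω, C ω)) P) (hBC : IndepFun B C P) :
    IndepFun (fun ω => (A ω, B ω)) C P := by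
  have hAB : IndepFun A B P := hABC.comp (φ := id) (ψ := Prod.fst) measurable_id measurable_fst
  have := Measure.isProbabilityMeasure_map (μ := P) hA.aemeasurable
  have := Measure.isProbabilityMeasure_map (μ := P) hB.aemeasurable
  have := Measure.isProbabilityMeasure_map (μ := P) hC.aemeasurable
  rw [indepFun_iff_map_prod_eq_prod_map_map (by fun_prop) (by fun_prop)] at *
  refine MeasurableEquiv.prodAssoc.map_measurableEquiv_injective ?_
  rw [hAB, Measure.prodAssoc_prod, ← hBC, ← hABC,
    Measure.map_map MeasurableEquiv.prodAssoc.measurable (by fun_prop)]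
  rfl

variable [MetricSpace 𝕏] [CompactSpace 𝕏] [MeasurableSpace 𝕏] [BorelSpace 𝕏] [MeasurableSpace Ω]

/-- The standing assumptions: a Gaussian random path `ξ`, an independent sequence `U` of
independent standard normal noise variables, and a sequential design `X`. -/
structure IsObservationModel (P : Measure Ω) (τ : 𝕏 → ℝ) (ξ : Ω → C(𝕏, ℝ)) (U : ℕ → Ω → ℝ)
    (X : ℕ → Ω → 𝕏) : Prop where
  continuous_noise : Continuous τ
  measurable_path : Measurable ξ
  isGaussian_path : IsGaussian (P.map ξ)
  measurable_noise : ∀ n, Measurable (U n)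
  noise_law : ∀ n, P.map (U n) = gaussianReal 0 1
  iIndepFun_noise : iIndepFun U P
  indepFun_path_noise : IndepFun ξ (fun ω n => U n ω) P
  isSequentialDesign : IsSequentialDesign τ ξ U X

namespace IsObservationModel

variable {P : Measure Ω} {τ : 𝕏 → ℝ} {ξ : Ω → C(𝕏, ℝ)} {U : ℕ → Ω → ℝ}
  {X : ℕ → Ω → 𝕏}

lemma measurable_history (M : IsObservationModel P τ ξ U X) (n : ℕ) :
    Measurable (history τ ξ U X n) := by
  induction n with
  | zero => exact measurable_pi_iff.2 fun i => i.elim0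
  | succ n ih =>
    have hX : Measurable (X n) := (M.isSequentialDesign n).mono ih.comap_le le_rfl
    have hev : Measurable fun p : C(𝕏, ℝ) × 𝕏 => p.1 p.2 := continuous_eval.measurable
    have hobs : Measurable (obs τ ξ U X n) :=
      (hev.comp (M.measurable_path.prodMk hX)).add
        ((M.continuous_noise.measurable.comp hX).mul (M.measurable_noise n))
    have e : history τ ξ U X (n + 1)
        = fun ω => appendData (history τ ξ U X n ω) (X n ω, obs τ ξ U X n ω) :=
      funext fun ω => history_succ τ ξ U X n ω
    rw [e]
    exact measurable_appendData.comp (ih.prodMk (hX.prodMk hobs))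

lemma measurable_obs (M : IsObservationModel P τ ξ U X) (n : ℕ) : Measurable (obs τ ξ U X n) :=
  measurable_snd.comp ((measurable_pi_apply (Fin.last n)).comp (M.measurable_history (n + 1)))

/-- The decision rule: the design point as a measurable function of the data. -/
lemma exists_rule [Nonempty 𝕏] (M : IsObservationModel P τ ξ U X) (n : ℕ) :
    ∃ x : (Fin n → 𝕏 × ℝ) → 𝕏, Measurable x ∧ ∀ ω, X n ω = x (history τ ξ U X n ω) := by
  obtain ⟨x, hx, he⟩ := (M.isSequentialDesign n).exists_eq_measurable_comp
  exact ⟨x, hx, fun ω => congrFun he ω⟩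

/-- The data are a measurable function of the path and of the past noise variables. -/
lemma exists_history_eq [Nonempty 𝕏] (M : IsObservationModel P τ ξ U X) (n : ℕ) :
    ∃ G : C(𝕏, ℝ) × (Finset.range n → ℝ) → (Fin n → 𝕏 × ℝ), Measurable G ∧
      ∀ ω, history τ ξ U X n ω = G (ξ ω, fun i => U i ω) := by
  induction n with
  | zero => exact ⟨fun _ i => i.elim0, by fun_prop, fun ω => by funext i; exact i.elim0⟩
  | succ n ih =>
    obtain ⟨G, hG, he⟩ := ih
    obtain ⟨x, hx, hxe⟩ := M.exists_rule n
    let incl : Finset.range n → Finset.range (n + 1) := fun i =>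
      ⟨i, Finset.mem_range.2 ((Finset.mem_range.1 i.2).trans n.lt_succ_self)⟩
    let last : Finset.range (n + 1) := ⟨n, Finset.mem_range.2 n.lt_succ_self⟩
    let past : C(𝕏, ℝ) × (Finset.range (n + 1) → ℝ) → (Fin n → 𝕏 × ℝ) := fun q =>
      G (q.1, fun i => q.2 (incl i))
    have hpast : Measurable past := hG.comp (by fun_prop)
    have hobs : Measurable fun q : C(𝕏, ℝ) × (Finset.range (n + 1) → ℝ) =>
        pastObs τ x (past q, q.1, q.2 last) :=
      (measurable_pastObs M.continuous_noise hx).comp (by fun_prop)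
    refine ⟨fun q => appendData (past q) (x (past q), pastObs τ x (past q, q.1, q.2 last)),
      measurable_appendData.comp (hpast.prodMk ((hx.comp hpast).prodMk hobs)), fun ω => ?_⟩
    rw [history_succ, hxe, obs, hxe, he]
    rfl

variable [IsProbabilityMeasure P]

/-- The next noise variable is independent of the data and the path. -/
lemma indepFun_noise [Nonempty 𝕏] (M : IsObservationModel P τ ξ U X) (n : ℕ) :
    IndepFun (fun ω => (history τ ξ U X n ω, ξ ω)) (U n) P := by
  obtain ⟨G, hG, he⟩ := M.exists_history_eq n
  have h1 : IndepFun (fun ω (i : Finset.range n) => U i ω) (U n) P := by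
    have := M.iIndepFun_noise.indepFun_finset (Finset.range n) {n} (by simp) M.measurable_noise
    exact this.comp (φ := id) (ψ := fun w : ({n} : Finset ℕ) → ℝ => w ⟨n, by simp⟩)
      measurable_id (by fun_prop)
  have h2 : IndepFun ξ (fun ω => ((fun i : Finset.range n => U i ω), U n ω)) P :=
    M.indepFun_path_noise.comp (φ := id) (ψ := fun w : ℕ → ℝ =>
      ((fun i : Finset.range n => w i), w n)) measurable_id (by fun_prop)
  have hUm := M.measurable_noise
  have h3 := indepFun_prodMk_of_indepFun M.measurable_path (by fun_prop) (M.measurable_noise n)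
    h2 h1
  have h4 := h3.comp (φ := fun q => (G q, q.1)) (ψ := id) (by fun_prop) measurable_id
  have e : (fun ω => (history τ ξ U X n ω, ξ ω))
      = (fun q => (G q, q.1)) ∘ fun ω => (ξ ω, fun i : Finset.range n => U i ω) := by
    funext ω; simp [he]
  rw [e]
  exact h4

/-- The joint law of the data, the path and the next noise variable. -/
lemma map_history_path_noise [Nonempty 𝕏] (M : IsObservationModel P τ ξ U X) (n : ℕ) :
    P.map (fun ω => (history τ ξ U X n ω, ξ ω, U n ω)) =
      P.map (history τ ξ U X n) ⊗ₘ noiseKernel (condDistrib ξ (history τ ξ U X n) P) := by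
  have hh := M.measurable_history n
  have hξ := M.measurable_path
  have hU := M.measurable_noise n
  have hind := (indepFun_iff_map_prod_eq_prod_map_map (by fun_prop) (by fun_prop)).1
    (M.indepFun_noise n)
  rw [M.noise_law, ← compProd_map_condDistrib hξ.aemeasurable] at hind
  refine Measure.ext_of_lintegral _ fun F hF => ?_
  have hF' : Measurable fun q : ((Fin n → 𝕏 × ℝ) × C(𝕏, ℝ)) × ℝ => F (q.1.1, q.1.2, q.2) := by
    fun_prop
  have h1 := lintegral_map (μ := P) hF' ((hh.prodMk hξ).prodMk hU)
  rw [lintegral_map hF (by fun_prop), Measure.lintegral_compProd hF]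
  refine h1.symm.trans ?_
  rw [hind, lintegral_prod _ hF'.aemeasurable, Measure.lintegral_compProd hF'.lintegral_prod_right']
  refine lintegral_congr fun h => ?_
  rw [noiseKernel_apply, lintegral_prod _ (by fun_prop)]

/-- The joint law of the data, the next observation and the path, disintegrated with respect to
the next posterior. -/
lemma map_obs_path_eq_compProd [Nonempty 𝕏] (M : IsObservationModel P τ ξ U X) (n : ℕ)
    {x : (Fin n → 𝕏 × ℝ) → 𝕏} (hx : Measurable x) (hX : ∀ ω, X n ω = x (history τ ξ U X n ω)) :
    P.map (fun ω => ((history τ ξ U X n ω, obs τ ξ U X n ω), ξ ω)) =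
      P.map (fun ω => (history τ ξ U X n ω, obs τ ξ U X n ω)) ⊗ₘ
        (condDistrib ξ (history τ ξ U X (n + 1)) P).comap
          (fun q : (Fin n → 𝕏 × ℝ) × ℝ => appendData q.1 (x q.1, q.2))
          (measurable_appendData_rule hx) := by
  have hh := M.measurable_history n
  have hh' := M.measurable_history (n + 1)
  have hξ := M.measurable_path
  have hobs := M.measurable_obs n
  refine Measure.ext_of_lintegral _ fun F hF => ?_
  -- the data and the next observation are functions of the next data
  let ψ : (Fin (n + 1) → 𝕏 × ℝ) → (Fin n → 𝕏 × ℝ) × ℝ := fun h =>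
    (fun i => h i.castSucc, (h (Fin.last n)).2)
  have hψ : Measurable ψ := by
    refine (measurable_pi_iff.2 fun i => measurable_pi_apply _).prodMk ?_
    exact measurable_snd.comp (measurable_pi_apply _)
  have hψe : ∀ ω, ψ (history τ ξ U X (n + 1) ω) = (history τ ξ U X n ω, obs τ ξ U X n ω) :=
    fun ω => rfl
  have hF' : Measurable fun q : (Fin (n + 1) → 𝕏 × ℝ) × C(𝕏, ℝ) => F (ψ q.1, q.2) := by fun_prop
  have hFi : Measurable fun q : (Fin n → 𝕏 × ℝ) × ℝ => ∫⁻ e, F (q, e)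
      ∂(condDistrib ξ (history τ ξ U X (n + 1)) P).comap
          (fun q : (Fin n → 𝕏 × ℝ) × ℝ => appendData q.1 (x q.1, q.2))
          (measurable_appendData_rule hx) q :=
    hF.lintegral_kernel_prod_right'
  have h1 := lintegral_map (μ := P) hF' (hh'.prodMk hξ)
  rw [← compProd_map_condDistrib hξ.aemeasurable, Measure.lintegral_compProd hF',
    lintegral_map hF'.lintegral_kernel_prod_right' hh'] at h1
  rw [lintegral_map hF (by fun_prop), Measure.lintegral_compProd hF,
    lintegral_map hFi (by fun_prop)]
  refine h1.symm.trans (lintegral_congr fun ω => ?_)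
  rw [Kernel.comap_apply]
  dsimp only
  rw [hψe, history_succ, hX]

/-- If the posterior after `n` observations is almost surely Gaussian, the next one is given by
the Gaussian update. -/
lemma condDistrib_succ_ae_eq [Nonempty 𝕏] (M : IsObservationModel P τ ξ U X) (n : ℕ)
    {x : (Fin n → 𝕏 × ℝ) → 𝕏} (hx : Measurable x) (hX : ∀ ω, X n ω = x (history τ ξ U X n ω))
    (hG : ∀ᵐ ω ∂P, IsGaussian (posterior P τ ξ U X n ω)) :
    ∀ᵐ q ∂P.map (fun ω => (history τ ξ U X n ω, obs τ ξ U X n ω)),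
      condDistrib ξ (history τ ξ U X (n + 1)) P (appendData q.1 (x q.1, q.2)) =
        updateKernel τ x (condDistrib ξ (history τ ξ U X n) P) q := by
  have hh := M.measurable_history n
  have hξ := M.measurable_path
  have hU := M.measurable_noise n
  have hτ := M.continuous_noise
  have := Measure.isProbabilityMeasure_map (μ := P) hh.aemeasurable
  set κ := condDistrib ξ (history τ ξ U X n) P
  have := isMarkovKernel_updateKernel τ x κ hτ hx
  have hg := measurable_pastObs hτ hx
  have h1 := map_pastObs_eq_compProd_updateKernel τ x κ hτ hx P hh hG
  rw [← M.map_history_path_noise n, Measure.map_map (by fun_prop) (by fun_prop),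
    Measure.map_map (by fun_prop) (by fun_prop)] at h1
  have e1 : (fun q : (Fin n → 𝕏 × ℝ) × C(𝕏, ℝ) × ℝ => ((q.1, pastObs τ x q), q.2.1))
      ∘ (fun ω => (history τ ξ U X n ω, ξ ω, U n ω))
      = fun ω => ((history τ ξ U X n ω, obs τ ξ U X n ω), ξ ω) := by
    funext ω; simp [pastObs, obs, hX]
  have e2 : (fun q : (Fin n → 𝕏 × ℝ) × C(𝕏, ℝ) × ℝ => (q.1, pastObs τ x q))
      ∘ (fun ω => (history τ ξ U X n ω, ξ ω, U n ω))
      = fun ω => (history τ ξ U X n ω, obs τ ξ U X n ω) := by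
    funext ω; simp [pastObs, obs, hX]
  rw [e1, e2, M.map_obs_path_eq_compProd n hx hX] at h1
  exact Kernel.ae_eq_of_compProd_eq h1

/-- All posteriors are almost surely Gaussian. -/
lemma ae_isGaussian_posterior [Nonempty 𝕏] (M : IsObservationModel P τ ξ U X) (n : ℕ) :
    ∀ᵐ ω ∂P, IsGaussian (posterior P τ ξ U X n ω) := by
  induction n with
  | zero =>
    have hconst : history τ ξ U X 0 = fun _ => (fun i => i.elim0) := by
      funext ω i; exact i.elim0
    have h2 : condDistrib ξ (history τ ξ U X 0) P ∘ₘ P.map (history τ ξ U X 0) = P.map ξ :=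
      condDistrib_comp_map (M.measurable_history 0).aemeasurable M.measurable_path.aemeasurable
    have h3 : P.map (history τ ξ U X 0) = Measure.dirac (fun i => i.elim0) := by
      conv_lhs => rw [hconst]
      rw [Measure.map_const]; simp
    rw [h3, Measure.dirac_bind (Kernel.measurable _)] at h2
    have := M.isGaussian_path
    refine ae_of_all _ fun ω => ?_
    have e : history τ ξ U X 0 ω = fun i => i.elim0 := by funext i; exact i.elim0
    rw [posterior, e, h2]
    infer_instance
  | succ n ih =>
    obtain ⟨x, hx, hX⟩ := M.exists_rule n
    have hh := M.measurable_history n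
    have hobs := M.measurable_obs n
    filter_upwards [ih, ae_of_ae_map (hh.prodMk hobs).aemeasurable
      (M.condDistrib_succ_ae_eq n hx hX ih)] with ω hω h1
    rw [← hX, ← history_succ, updateKernel_apply τ x _ M.continuous_noise hx] at h1
    have : IsGaussian (condDistrib ξ (history τ ξ U X n) P (history τ ξ U X n ω)) := hω
    rw [posterior, h1]
    infer_instance

end IsObservationModel

end Model

/-! ### The gains of the design tend to zero -/

/-- Nonnegative random variables whose expectations have bounded partial sums tend to `0`. -/
lemma ae_tendsto_zero_of_sum_integral_le {Ω : Type*} [MeasurableSpace Ω] {P : Measure Ω}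
    {g : ℕ → Ω → ℝ} (hg : ∀ n, Integrable (g n) P) (h0 : ∀ n, 0 ≤ᵐ[P] g n) {C : ℝ}
    (hC : ∀ N, ∑ n ∈ Finset.range N, ∫ ω, g n ω ∂P ≤ C) :
    ∀ᵐ ω ∂P, Tendsto (fun n => g n ω) atTop (𝓝 0) := by
  have hm : ∀ n, AEMeasurable (fun ω => ENNReal.ofReal (g n ω)) P := fun n =>
    (hg n).1.aemeasurable.ennreal_ofReal
  have hsum : ∫⁻ ω, ∑' n, ENNReal.ofReal (g n ω) ∂P ≠ ⊤ := by
    rw [lintegral_tsum hm]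
    refine ne_top_of_le_ne_top (ENNReal.ofReal_ne_top (r := C)) ?_
    refine ENNReal.tsum_le_of_sum_range_le fun N => ?_
    have e : ∀ n, ∫⁻ ω, ENNReal.ofReal (g n ω) ∂P = ENNReal.ofReal (∫ ω, g n ω ∂P) := fun n =>
      (ofReal_integral_eq_lintegral_ofReal (hg n) (h0 n)).symm
    simp_rw [e]
    rw [← ENNReal.ofReal_sum_of_nonneg fun n _ => integral_nonneg_of_ae (h0 n)]
    exact ENNReal.ofReal_le_ofReal (hC N)
  have hfin := ae_lt_top' (AEMeasurable.tsum hm) hsum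
  filter_upwards [hfin, ae_all_iff.2 h0] with ω hω h0ω
  have h1 := ENNReal.tendsto_atTop_zero_of_tsum_ne_top hω.ne
  have h2 := (ENNReal.tendsto_toReal ENNReal.zero_ne_top).comp h1
  refine h2.congr fun n => ?_
  simp [ENNReal.toReal_ofReal (h0ω n)]

namespace IsObservationModel

variable {𝕏 Ω : Type*} [MetricSpace 𝕏] [CompactSpace 𝕏] [MeasurableSpace 𝕏]
  [MeasurableSpace Ω] {P : Measure Ω} {τ : 𝕏 → ℝ} {ξ : Ω → C(𝕏, ℝ)}
  {U : ℕ → Ω → ℝ} {X : ℕ → Ω → 𝕏}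

lemma memLp_path (M : IsObservationModel P τ ξ U X) : MemLp ξ 2 P :=
  HasGaussianLaw.memLp_two ⟨M.isGaussian_path⟩

variable [IsProbabilityMeasure P]

lemma integrable_path (M : IsObservationModel P τ ξ U X) : Integrable ξ P :=
  M.memLp_path.integrable (by simp)

variable [BorelSpace 𝕏]

/-- Integrals with respect to the posterior are conditional expectations given the data. -/
lemma condExp_ae_eq_integral_posterior (M : IsObservationModel P τ ξ U X) (n : ℕ)
    {g : C(𝕏, ℝ) → ℝ} (hg : Continuous g) (hint : Integrable (fun ω => g (ξ ω)) P) :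
    P[fun ω => g (ξ ω) | dataAlgebra τ ξ U X n] =ᵐ[P] fun ω => ∫ f, g f ∂posterior P τ ξ U X n ω :=
  condExp_ae_eq_integral_condDistrib (M.measurable_history n) M.measurable_path.aemeasurable
    hg.stronglyMeasurable hint

variable [Nonempty 𝕏]

/-- The current maximum of the posterior mean function. -/
noncomputable def topMean (P : Measure Ω) [IsFiniteMeasure P] (τ : 𝕏 → ℝ) (ξ : Ω → C(𝕏, ℝ))
    (U : ℕ → Ω → ℝ) (X : ℕ → Ω → 𝕏) (n : ℕ) (ω : Ω) : ℝ :=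
  ⨆ u, meanFun (posterior P τ ξ U X n ω) u

lemma integrable_topMean (M : IsObservationModel P τ ξ U X) (n : ℕ) :
    Integrable (topMean P τ ξ U X n) P := by
  have h0 : Integrable (fun q : (Fin n → 𝕏 × ℝ) × C(𝕏, ℝ) => q.2)
      (P.map fun ω => (history τ ξ U X n ω, ξ ω)) := by
    rw [integrable_map_measure (by fun_prop)
      ((M.measurable_history n).prodMk M.measurable_path).aemeasurable]
    exact M.integrable_path
  have h1 : Integrable (fun ω => ∫ f, f ∂posterior P τ ξ U X n ω) P :=
    h0.integral_condDistrib (M.measurable_history n).aemeasurable M.measurable_path.aemeasurable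
  refine (integrable_sup h1).congr ?_
  filter_upwards [M.ae_isGaussian_posterior n] with ω hω
  rw [topMean]
  simp_rw [meanFun_eq (integrable_id_of_isGaussian (posterior P τ ξ U X n ω))]

/-- By Jensen's inequality, in the form `max m_n ≤ 𝔼[max ξ | data]`. -/
lemma integral_topMean_le (M : IsObservationModel P τ ξ U X) (n : ℕ) :
    ∫ ω, topMean P τ ξ U X n ω ∂P ≤ ∫ ω, ⨆ u, ξ ω u ∂P := by
  have hi := integrable_sup M.integrable_path
  have h1 := M.condExp_ae_eq_integral_posterior n continuous_sup hi
  rw [← integral_condExp (M.measurable_history n).comap_le (f := fun ω => ⨆ u, ξ ω u)]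
  refine integral_mono_ae (M.integrable_topMean n) integrable_condExp ?_
  filter_upwards [h1, M.ae_isGaussian_posterior n] with ω hω hG
  rw [hω]
  have hid := integrable_id_of_isGaussian (posterior P τ ξ U X n ω)
  refine ciSup_le fun u => ?_
  exact integral_mono ((evalAt u).integrable_comp hid) (integrable_sup hid) fun f => le_sup f u

/-- The gain at the actual design point is, on average, the increase of the maximum of the
posterior mean. -/
lemma integral_knowledgeGain (M : IsObservationModel P τ ξ U X) (n : ℕ) :
    Integrable (fun ω => knowledgeGain τ (X n ω) (posterior P τ ξ U X n ω)) P ∧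
    ∫ ω, knowledgeGain τ (X n ω) (posterior P τ ξ U X n ω) ∂P =
      ∫ ω, topMean P τ ξ U X (n + 1) ω ∂P - ∫ ω, topMean P τ ξ U X n ω ∂P := by
  obtain ⟨x, hx, hX⟩ := M.exists_rule n
  have hh := M.measurable_history n
  have hξ := M.measurable_path
  have hU := M.measurable_noise n
  have hτ := M.continuous_noise
  have hobs := M.measurable_obs n
  have := Measure.isProbabilityMeasure_map (μ := P) hh.aemeasurable
  have hG := M.ae_isGaussian_posterior n
  set κ := condDistrib ξ (history τ ξ U X n) P with hκ
  have := isMarkovKernel_updateKernel τ x κ hτ hx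
  have hg := measurable_pastObs hτ hx
  -- the maximum of the mean function after the update
  let S : (Fin n → 𝕏 × ℝ) × ℝ → ℝ := fun q => ⨆ u, (∫ f, f ∂updateKernel τ x κ q) u
  have hS : StronglyMeasurable S := by
    have h1 : StronglyMeasurable fun q : (Fin n → 𝕏 × ℝ) × ℝ => ∫ f, f ∂updateKernel τ x κ q :=
      (measurable_snd.stronglyMeasurable :
        StronglyMeasurable fun q : ((Fin n → 𝕏 × ℝ) × ℝ) × C(𝕏, ℝ) =>
          q.2).integral_kernel_prod_right'
    exact continuous_sup.comp_stronglyMeasurable h1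
  have htop : topMean P τ ξ U X (n + 1) =ᵐ[P] fun ω =>
      S (history τ ξ U X n ω, obs τ ξ U X n ω) := by
    filter_upwards [M.ae_isGaussian_posterior (n + 1), ae_of_ae_map (hh.prodMk hobs).aemeasurable
      (M.condDistrib_succ_ae_eq n hx hX hG)] with ω hω h1
    rw [← hX, ← history_succ] at h1
    change posterior P τ ξ U X (n + 1) ω = updateKernel τ x κ _ at h1
    rw [topMean]
    simp_rw [meanFun_eq (integrable_id_of_isGaussian (posterior P τ ξ U X (n + 1) ω))]
    simp only [S, h1]
  let F : (Fin n → 𝕏 × ℝ) × C(𝕏, ℝ) × ℝ → ℝ := fun q => S (q.1, pastObs τ x q)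
  have hF : StronglyMeasurable F := hS.comp_measurable (measurable_fst.prodMk hg)
  have hFe : ∀ ω, F (history τ ξ U X n ω, ξ ω, U n ω)
      = S (history τ ξ U X n ω, obs τ ξ U X n ω) := fun ω => by
    simp [F, pastObs, obs, hX]
  have hFint : Integrable F (P.map (history τ ξ U X n) ⊗ₘ noiseKernel κ) := by
    rw [hκ, ← M.map_history_path_noise n,
      integrable_map_measure hF.aestronglyMeasurable (by fun_prop)]
    refine ((M.integrable_topMean (n + 1)).congr htop).congr (ae_of_all _ fun ω => ?_)
    exact (hFe ω).symm
  have hFIm : StronglyMeasurable fun h => ∫ p, F (h, p) ∂noiseKernel κ h :=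
    hF.integral_kernel_prod_right'
  have hFI : Integrable (fun h => ∫ p, F (h, p) ∂noiseKernel κ h) (P.map (history τ ξ U X n)) :=
    ((Measure.integrable_compProd_iff hFint.1).1 hFint).2.mono' hFIm.aestronglyMeasurable
      (ae_of_all _ fun h => norm_integral_le_integral_norm _)
  have hFIP : Integrable (fun ω => ∫ p, F (history τ ξ U X n ω, p)
      ∂noiseKernel κ (history τ ξ U X n ω)) P := hFI.comp_measurable hh
  have hgain : (fun ω => knowledgeGain τ (X n ω) (posterior P τ ξ U X n ω)) =ᵐ[P] fun ω =>
      (∫ p, F (history τ ξ U X n ω, p) ∂noiseKernel κ (history τ ξ U X n ω))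
        - topMean P τ ξ U X n ω := by
    filter_upwards [hG] with ω hω
    rw [knowledgeGain, topMean, noiseKernel_apply]
    congr 1
    refine integral_congr_ae ?_
    have hω' : IsGaussian (κ (history τ ξ U X n ω)) := hω
    filter_upwards [ae_of_ae_map (measurable_obsMap τ (X n ω)).aemeasurable
        (condAt_ae_eq τ (X n ω) (posterior P τ ξ U X n ω)),
      ae_of_ae_map (measurable_obsMap τ (X n ω)).aemeasurable
        (isGaussian_condAt τ (X n ω) (posterior P τ ξ U X n ω))] with p hp hpG
    simp_rw [meanFun_eq (integrable_id_of_isGaussian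
      (condAt τ (X n ω) (posterior P τ ξ U X n ω) (p.1 (X n ω) + τ (X n ω) * p.2)))]
    have e : updateKernel τ x κ (history τ ξ U X n ω, pastObs τ x (history τ ξ U X n ω, p))
        = condAt τ (X n ω) (posterior P τ ξ U X n ω) (p.1 (X n ω) + τ (X n ω) * p.2) := by
      rw [hp, updateKernel_apply τ x κ hτ hx]
      simp only [pastObs, ← hX]
      rfl
    simp only [F, S, e]
  refine ⟨(hFIP.sub (M.integrable_topMean n)).congr hgain.symm, ?_⟩
  rw [integral_congr_ae hgain, integral_sub hFIP (M.integrable_topMean n)]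
  congr 1
  rw [integral_congr_ae htop, ← integral_map hh.aemeasurable hFIm.aestronglyMeasurable
    (f := fun h => ∫ p, F (h, p) ∂noiseKernel κ h), ← Measure.integral_compProd hFint, hκ,
    ← M.map_history_path_noise n, integral_map (by fun_prop) hF.aestronglyMeasurable]
  exact integral_congr_ae (ae_of_all _ hFe)

/-- The maximum of the posterior mean is increasing and bounded on average, so that the gains at
the design points are summable. -/
lemma ae_tendsto_knowledgeGain (M : IsObservationModel P τ ξ U X) :
    ∀ᵐ ω ∂P, Tendsto (fun n => knowledgeGain τ (X n ω) (posterior P τ ξ U X n ω)) atTop (𝓝 0) := by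
  refine ae_tendsto_zero_of_sum_integral_le (fun n => (M.integral_knowledgeGain n).1)
    (fun n => ?_) (C := (∫ ω, ⨆ u, ξ ω u ∂P) - ∫ ω, topMean P τ ξ U X 0 ω ∂P) fun N => ?_
  · filter_upwards [M.ae_isGaussian_posterior n] with ω hω
    exact knowledgeGain_nonneg τ (X n ω) (posterior P τ ξ U X n ω)
  · simp_rw [fun n => (M.integral_knowledgeGain n).2]
    rw [Finset.sum_range_sub (fun n => ∫ ω, topMean P τ ξ U X n ω ∂P)]
    have := M.integral_topMean_le N
    linarith

end IsObservationModel

/-! ### Conditional variances and uniform convergence of the posterior means -/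

lemma variance_sub_le {Ω : Type*} [MeasurableSpace Ω] {P : Measure Ω} [IsFiniteMeasure P]
    {A B : Ω → ℝ} (hA : MemLp A 2 P) (hB : MemLp B 2 P) :
    Var[A - B; P] ≤ 2 * Var[A; P] + 2 * Var[B; P] := by
  have h1 := variance_add hA hB
  have h2 := variance_sub hA hB
  have h3 := variance_nonneg (A + B) P
  linarith

/-- Nonnegative variables with expectations tending to `0` tend to `0` along a subsequence. -/
lemma exists_subseq_ae_tendsto_zero {Ω : Type*} [MeasurableSpace Ω] {P : Measure Ω}
    {g : ℕ → Ω → ℝ} (hg : ∀ n, Integrable (g n) P) (h0 : ∀ n, 0 ≤ᵐ[P] g n)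
    (hlim : Tendsto (fun n => ∫ ω, g n ω ∂P) atTop (𝓝 0)) :
    ∃ ns : ℕ → ℕ, StrictMono ns ∧ ∀ᵐ ω ∂P, Tendsto (fun i => g (ns i) ω) atTop (𝓝 0) := by
  have h1 : TendstoInMeasure P g atTop fun _ => 0 := by
    refine tendstoInMeasure_of_tendsto_eLpNorm one_ne_zero (fun n => (hg n).1)
      aestronglyMeasurable_const ?_
    have e : ∀ n, eLpNorm (g n - fun _ => 0) 1 P = ENNReal.ofReal (∫ ω, g n ω ∂P) := fun n => by
      have : (g n - fun _ => (0 : ℝ)) = g n := by funext ω; simp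
      rw [this, eLpNorm_one_eq_lintegral_enorm, ← ofReal_integral_norm_eq_lintegral_enorm (hg n)]
      congr 1
      refine integral_congr_ae ?_
      filter_upwards [h0 n] with ω hω
      rw [Real.norm_eq_abs, abs_of_nonneg hω]
    simp_rw [e]
    simpa [Function.comp_def] using (ENNReal.continuous_ofReal.tendsto 0).comp hlim
  exact h1.exists_seq_tendsto_ae

/-- Convergence of the increments of the mean functions at the interpolation nodes upgrades to
uniform convergence, if the mean interpolation errors are eventually small. -/
lemma eventually_abs_increment_sub_le {𝕏 : Type*} [MetricSpace 𝕏] [CompactSpace 𝕏]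
    {s : ℕ → Finset 𝕏} {φ : ℕ → 𝕏 → C(𝕏, ℝ)} (h0 : ∀ k x u, 0 ≤ φ k x u)
    (h1 : ∀ k u, ∑ x ∈ s k, φ k x u = 1) {ν : ℕ → Measure C(𝕏, ℝ)}
    (hν : ∀ n, Integrable (fun f : C(𝕏, ℝ) => f) (ν n)) (g : C(𝕏, ℝ)) (u₀ : 𝕏)
    (hnode : ∀ k, ∀ x ∈ s k, Tendsto (fun n => meanFun (ν n) x - meanFun (ν n) u₀) atTop
      (𝓝 (g x - g u₀)))
    {W : ℕ → ℝ} (hW : ∀ k, Tendsto (fun n => ∫ f, ‖f - interp (s k) (φ k) f‖ ∂ν n) atTop (𝓝 (W k)))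
    (hsmall : ∀ ε > 0, ∃ k, W k < ε ∧ ‖g - interp (s k) (φ k) g‖ < ε) {ε : ℝ} (hε : 0 < ε) :
    ∀ᶠ n in atTop, ∀ u, |(meanFun (ν n) u - meanFun (ν n) u₀) - (g u - g u₀)| ≤ ε := by
  obtain ⟨k, hk1, hk2⟩ := hsmall (ε / 3) (by positivity)
  have hev1 : ∀ᶠ n in atTop, ∫ f, ‖f - interp (s k) (φ k) f‖ ∂ν n < ε / 3 :=
    (hW k).eventually_lt_const hk1
  have hev2 : ∀ᶠ n in atTop, ∀ x ∈ s k,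
      |(meanFun (ν n) x - meanFun (ν n) u₀) - (g x - g u₀)| < ε / 3 := by
    refine (eventually_all_finset _).2 fun x hx => ?_
    have := (Metric.tendsto_nhds.1 (hnode k x hx)) (ε / 3) (by positivity)
    filter_upwards [this] with n hn
    rwa [Real.dist_eq] at hn
  filter_upwards [hev1, hev2] with n hn1 hn2 u
  have hnode' := abs_sum_mul_le (h0 k) (h1 k) u
    (fun x => (meanFun (ν n) x - meanFun (ν n) u₀) - (g x - g u₀)) (C := ε / 3)
    fun x hx _ => (hn2 x hx).le
  have hi : ∀ x, Integrable (fun f : C(𝕏, ℝ) => f x) (ν n) := fun x =>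
    (evalAt x).integrable_comp (hν n)
  have hT : Integrable (fun f => interp (s k) (φ k) f) (ν n) :=
    (hν n).norm.mono' ((continuous_interp _ _).aestronglyMeasurable.comp_aemeasurable
      (hν n).1.aemeasurable) (ae_of_all _ fun f => norm_interp_le (h0 k) (h1 k) f)
  have hTi : Integrable (fun f => interp (s k) (φ k) f u) (ν n) := (evalAt u).integrable_comp hT
  -- the mean interpolation error bounds the interpolation error of the mean
  have hmean : |meanFun (ν n) u - ∑ x ∈ s k, meanFun (ν n) x * φ k x u|
      ≤ ∫ f, ‖f - interp (s k) (φ k) f‖ ∂ν n := by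
    have e : ∑ x ∈ s k, meanFun (ν n) x * φ k x u = ∫ f, interp (s k) (φ k) f u ∂ν n := by
      simp_rw [interp_apply, meanFun]
      rw [integral_finsetSum _ fun x _ => (hi x).mul_const _]
      simp_rw [integral_mul_const]
    rw [e, meanFun, ← integral_sub (hi u) hTi]
    refine abs_integral_le_integral_abs.trans ?_
    exact integral_mono ((evalAt u).integrable_comp ((hν n).sub hT)).abs ((hν n).sub hT).norm
      fun f => (f - interp (s k) (φ k) f).norm_coe_le_norm u
  have hg : |g u - ∑ x ∈ s k, g x * φ k x u| ≤ ‖g - interp (s k) (φ k) g‖ := by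
    rw [← interp_apply]
    exact (g - interp (s k) (φ k) g).norm_coe_le_norm u
  simp only [sub_mul, Finset.sum_sub_distrib, ← Finset.mul_sum, h1, mul_one] at hnode'
  rw [abs_le] at *
  constructor <;> linarith [hnode'.1, hnode'.2, hmean.1, hmean.2, hg.1, hg.2]

namespace IsObservationModel

variable {𝕏 Ω : Type*} [MetricSpace 𝕏] [CompactSpace 𝕏] [MeasurableSpace 𝕏] [BorelSpace 𝕏]
  [MeasurableSpace Ω] {P : Measure Ω} {τ : 𝕏 → ℝ} {ξ : Ω → C(𝕏, ℝ)}
  {U : ℕ → Ω → ℝ} {X : ℕ → Ω → 𝕏}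

/-- The increasing sequence of data `σ`-algebras. -/
def dataFiltration (M : IsObservationModel P τ ξ U X) :
    Filtration ℕ (inferInstance : MeasurableSpace Ω) where
  seq := dataAlgebra τ ξ U X
  mono' := monotone_nat_of_le_succ fun n => by
    have hr : Measurable fun (h : Fin (n + 1) → 𝕏 × ℝ) (i : Fin n) => h i.castSucc :=
      measurable_pi_iff.2 fun i => measurable_pi_apply _
    have e : history τ ξ U X n = (fun h i => h i.castSucc) ∘ history τ ξ U X (n + 1) := rfl
    rw [dataAlgebra, e, ← MeasurableSpace.comap_comp]
    exact MeasurableSpace.comap_mono hr.comap_le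
  le' n := (M.measurable_history n).comap_le

variable [IsProbabilityMeasure P]

/-- Posterior expectations converge almost surely, by Lévy's upward theorem. -/
lemma ae_tendsto_integral_posterior (M : IsObservationModel P τ ξ U X) {g : C(𝕏, ℝ) → ℝ}
    (hg : Continuous g) (hint : Integrable (fun ω => g (ξ ω)) P) :
    ∀ᵐ ω ∂P, Tendsto (fun n => ∫ f, g f ∂posterior P τ ξ U X n ω) atTop
      (𝓝 ((P[fun ω => g (ξ ω) | ⨆ n, M.dataFiltration n]) ω)) := by
  filter_upwards [tendsto_ae_condExp (ℱ := M.dataFiltration) (μ := P) fun ω => g (ξ ω),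
    ae_all_iff.2 fun n => M.condExp_ae_eq_integral_posterior n hg hint] with ω h1 h2
  refine h1.congr fun n => ?_
  exact h2 n

variable [Nonempty 𝕏]

/-- If the posterior variance of an increment of the path tends to `0`, then this increment is
determined by the data, and the posterior mean of the increment converges to it. -/
lemma ae_tendsto_meanFun_sub (M : IsObservationModel P τ ξ U X) (u v : 𝕏)
    (hvar : ∀ᵐ ω ∂P, Tendsto (fun n => Var[fun f : C(𝕏, ℝ) => f u - f v; posterior P τ ξ U X n ω])
      atTop (𝓝 0)) :
    ∀ᵐ ω ∂P, Tendsto (fun n => meanFun (posterior P τ ξ U X n ω) u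
      - meanFun (posterior P τ ξ U X n ω) v) atTop (𝓝 (ξ ω u - ξ ω v)) := by
  set L : StrongDual ℝ C(𝕏, ℝ) := evalAt u - evalAt v with hL
  set D : Ω → ℝ := fun ω => L (ξ ω) with hD
  have hF : (⨆ n, M.dataFiltration n) ≤ (inferInstance : MeasurableSpace Ω) :=
    iSup_le M.dataFiltration.le'
  have hDmem : MemLp D 2 P := HasGaussianLaw.memLp_two
    ((⟨M.isGaussian_path⟩ : HasGaussianLaw ξ P).map_fun L)
  have hlim1 := M.ae_tendsto_integral_posterior L.continuous (hDmem.integrable (by simp))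
  have hlim2 := M.ae_tendsto_integral_posterior (g := fun f => L f ^ 2) (by fun_prop)
    hDmem.integrable_sq
  have hcv := condVar_ae_eq_condExp_sq_sub_sq_condExp hF hDmem
  -- the conditional variance given all the data is the limit of the posterior variances
  have hzero : Var[D; P | ⨆ n, M.dataFiltration n] =ᵐ[P] 0 := by
    filter_upwards [hvar, hlim1, hlim2, hcv, ae_all_iff.2 M.ae_isGaussian_posterior]
      with ω hv h1 h2 h3 hG
    rw [h3]
    refine tendsto_nhds_unique (h2.sub (h1.pow 2)) (hv.congr fun n => ?_)
    have := hG n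
    exact variance_eq_sub (IsGaussian.memLp_dual (posterior P τ ξ U X n ω) L 2 (by simp))
  have hsq : Integrable ((D - P[D | ⨆ n, M.dataFiltration n]) ^ 2) P :=
    (hDmem.sub (hDmem.condExp (by norm_num))).integrable_sq
  have hDF : D =ᵐ[P] P[D | ⨆ n, M.dataFiltration n] := by
    have h1 : ∫ ω, ((D - P[D | ⨆ n, M.dataFiltration n]) ^ 2) ω ∂P = 0 := by
      have h2 := setIntegral_condVar (hm := hF) hsq MeasurableSet.univ
      rw [setIntegral_univ, setIntegral_univ, integral_congr_ae hzero] at h2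
      simpa using h2.symm
    have h1 := (integral_eq_zero_iff_of_nonneg (fun ω => sq_nonneg _) hsq).1 h1
    filter_upwards [h1] with ω hω
    simpa [sub_eq_zero] using hω
  filter_upwards [hlim1, hDF, ae_all_iff.2 M.ae_isGaussian_posterior] with ω h1 h2 hG
  have h3 : D ω = ξ ω u - ξ ω v := rfl
  rw [← h3, h2]
  refine h1.congr fun n => ?_
  have := hG n
  have hid := integrable_id_of_isGaussian (posterior P τ ξ U X n ω)
  exact integral_sub ((evalAt u).integrable_comp hid) ((evalAt v).integrable_comp hid)

/-- Under a design whose criterion is asymptotically minimal, the posterior variance of the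
increments of the path tends to `0`. -/
lemma ae_tendsto_variance (M : IsObservationModel P τ ξ U X) {ε : ℕ → ℝ}
    (hε : Tendsto ε atTop (𝓝 0)) {n₀ : ℕ}
    (hopt : ∀ n ≥ n₀, ∀ᵐ ω ∂P, ∀ x : 𝕏,
      kgCriterion P τ ξ U X n (X n ω) ω ≤ kgCriterion P τ ξ U X n x ω + ε n) :
    ∀ᵐ ω ∂P, ∀ u v, Tendsto (fun n =>
      Var[fun f : C(𝕏, ℝ) => f u - f v; posterior P τ ξ U X n ω]) atTop (𝓝 0) := by
  have hb1 := M.ae_tendsto_integral_posterior (g := fun f => ‖f‖) continuous_norm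
    M.integrable_path.norm
  have hb2 := M.ae_tendsto_integral_posterior (g := fun f => ‖f‖ ^ 2) (by fun_prop)
    (M.memLp_path.integrable_norm_pow (by norm_num))
  have hopt' : ∀ᵐ ω ∂P, ∀ n, n₀ ≤ n → ∀ x : 𝕏,
      kgCriterion P τ ξ U X n (X n ω) ω ≤ kgCriterion P τ ξ U X n x ω + ε n :=
    ae_all_iff.2 fun n => by
      by_cases h : n₀ ≤ n
      · filter_upwards [hopt n h] with ω hω _ using hω
      · exact ae_of_all _ fun ω h' => absurd h' h
  obtain ⟨T, hT⟩ : ∃ T, ∀ x, τ x ^ 2 ≤ T := by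
    obtain ⟨T, hT⟩ := (isCompact_range (M.continuous_noise.pow 2)).bddAbove
    exact ⟨T, fun x => hT ⟨x, rfl⟩⟩
  filter_upwards [hb1, hb2, hopt', M.ae_tendsto_knowledgeGain,
    ae_all_iff.2 M.ae_isGaussian_posterior] with ω h1 h2 hopt hgain hG
  obtain ⟨B₁, hB₁⟩ := h1.bddAbove_range
  obtain ⟨B₂, hB₂⟩ := h2.bddAbove_range
  have hid : ∀ n, Integrable (fun f : C(𝕏, ℝ) => f) (posterior P τ ξ U X n ω) := fun n => by
    have := hG n
    exact integrable_id_of_isGaussian _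
  -- the increments are compared through the current maximizer `v n` of the posterior mean
  choose v hv using fun n => exists_meanFun_argmax (posterior P τ ξ U X n ω) (hid n)
  have hδ : Tendsto (fun n => knowledgeGain τ (X n ω) (posterior P τ ξ U X n ω) + ε n) atTop
      (𝓝 0) := by simpa using hgain.add hε
  have hmain : ∀ u, Tendsto (fun n =>
      Var[fun f : C(𝕏, ℝ) => f u - f (v n); posterior P τ ξ U X n ω]) atTop (𝓝 0) := by
    intro u
    rw [Metric.tendsto_nhds]
    intro η hη
    -- adding `1` to the bound keeps the standard deviation positive when `B₂ = T = 0`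
    have hB₂0 : 0 ≤ B₂ :=
      (integral_nonneg fun f => sq_nonneg ‖f‖).trans (hB₂ ⟨0, rfl⟩)
    have hT0 : 0 ≤ T := (sq_nonneg _).trans (hT (v 0))
    have hpos : 0 < posExcess (2 * B₁) (η / 2 / √(B₂ + (T + 1))) :=
      posExcess_pos (by positivity)
    filter_upwards [hδ.eventually_lt_const hpos, eventually_ge_atTop n₀] with n hn hn₀
    rw [Real.dist_eq, sub_zero, abs_of_nonneg (variance_nonneg _ _)]
    by_contra! hge
    have := hG n
    refine absurd (posExcess_le_of_variance_ge τ (posterior P τ ξ U X n ω) (hv n)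
      (hB₁ ⟨n, rfl⟩) (hB₂ ⟨n, rfl⟩) (T := T + 1) (fun x => (hT x).trans (by linarith))
      (fun x => ?_) hη hge) (not_le.2 hn)
    have h3 := hopt n hn₀ x
    rw [← kgUncertainty_sub_expectedResidual τ x _ (hid n),
      ← kgUncertainty_sub_expectedResidual τ (X n ω) _ (hid n)]
    simp only [kgCriterion] at h3
    linarith
  intro u w
  have hmem : ∀ n (L : StrongDual ℝ C(𝕏, ℝ)), MemLp L 2 (posterior P τ ξ U X n ω) := fun n L => by
    have := hG n
    exact IsGaussian.memLp_dual _ L 2 (by simp)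
  refine squeeze_zero (fun n => variance_nonneg _ _) (fun n => ?_)
    (by simpa using ((hmain u).const_mul 2).add ((hmain w).const_mul 2))
  have h4 := variance_sub_le (hmem n (evalAt u - evalAt (v n))) (hmem n (evalAt w - evalAt (v n)))
  refine le_trans (le_of_eq ?_) h4
  congr 1
  funext f
  simp

/-- Uniform convergence of the increments of the posterior mean to those of the path. -/
lemma ae_eventually_abs_increment_sub_le (M : IsObservationModel P τ ξ U X) {ε : ℕ → ℝ}
    (hε : Tendsto ε atTop (𝓝 0)) {n₀ : ℕ}
    (hopt : ∀ n ≥ n₀, ∀ᵐ ω ∂P, ∀ x : 𝕏,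
      kgCriterion P τ ξ U X n (X n ω) ω ≤ kgCriterion P τ ξ U X n x ω + ε n) (u₀ : 𝕏) :
    ∀ᵐ ω ∂P, ∀ η > 0, ∀ᶠ n in atTop, ∀ u,
      |(meanFun (posterior P τ ξ U X n ω) u - meanFun (posterior P τ ξ U X n ω) u₀)
        - (ξ ω u - ξ ω u₀)| ≤ η := by
  obtain ⟨s, φ, h0, h1, hlim⟩ := exists_interp_tendsto 𝕏
  have hvar := M.ae_tendsto_variance hε hopt
  have hnode : ∀ᵐ ω ∂P, ∀ k, ∀ x ∈ s k, Tendsto (fun n => meanFun (posterior P τ ξ U X n ω) x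
      - meanFun (posterior P τ ξ U X n ω) u₀) atTop (𝓝 (ξ ω x - ξ ω u₀)) := by
    refine ae_all_iff.2 fun k => (ae_ball_iff (s k).countable_toSet).2 fun x _ => ?_
    exact M.ae_tendsto_meanFun_sub x u₀ (hvar.mono fun ω hω => hω x u₀)
  set w : ℕ → C(𝕏, ℝ) → ℝ := fun k f => ‖f - interp (s k) (φ k) f‖ with hw
  have hwc : ∀ k, Continuous (w k) := fun k => (continuous_id.sub (continuous_interp _ _)).norm
  have hwle : ∀ k f, w k f ≤ 2 * ‖f‖ := fun k f => by
    have h2 := norm_sub_le f (interp (s k) (φ k) f)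
    have h3 := norm_interp_le (h0 k) (h1 k) f
    change ‖_‖ ≤ _
    linarith
  have hwint : ∀ k, Integrable (fun ω => w k (ξ ω)) P := fun k =>
    (M.integrable_path.norm.const_mul 2).mono'
      ((hwc k).measurable.comp M.measurable_path).aestronglyMeasurable
      (ae_of_all _ fun ω => by
        rw [Real.norm_eq_abs, abs_of_nonneg (norm_nonneg _)]; exact hwle k _)
  have hwlim : ∀ f, Tendsto (fun k => w k f) atTop (𝓝 0) := fun f => by
    have := (tendsto_const_nhds (x := f)).sub (hlim f)
    simpa using this.norm
  set W : ℕ → Ω → ℝ := fun k => P[fun ω => w k (ξ ω) | ⨆ n, M.dataFiltration n] with hWdef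
  have hF : (⨆ n, M.dataFiltration n) ≤ (inferInstance : MeasurableSpace Ω) :=
    iSup_le M.dataFiltration.le'
  have hWint : Tendsto (fun k => ∫ ω, W k ω ∂P) atTop (𝓝 0) := by
    have e : ∀ k, ∫ ω, W k ω ∂P = ∫ ω, w k (ξ ω) ∂P := fun k => integral_condExp hF
    simp_rw [e]
    have := tendsto_integral_of_dominated_convergence (μ := P) (F := fun k ω => w k (ξ ω))
      (f := fun _ => 0) (fun ω => 2 * ‖ξ ω‖) (fun k => (hwint k).1)
      (M.integrable_path.norm.const_mul 2) (fun k => ae_of_all _ fun ω => by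
        rw [Real.norm_eq_abs, abs_of_nonneg (norm_nonneg _)]; exact hwle k _)
      (ae_of_all _ fun ω => hwlim (ξ ω))
    simpa using this
  -- `W k` tends to `0` in `L¹`, and almost surely along a subsequence, which is enough to pick one
  -- good interpolation scheme for each `ω`
  obtain ⟨ns, hns, hWsub⟩ := exists_subseq_ae_tendsto_zero (fun k => integrable_condExp)
    (fun k => condExp_nonneg (ae_of_all _ fun ω => norm_nonneg _)) hWint
  filter_upwards [hnode, hWsub, ae_all_iff.2 M.ae_isGaussian_posterior,
    ae_all_iff.2 fun k => M.ae_tendsto_integral_posterior (hwc k) (hwint k)]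
    with ω hnode hWsub hG hWω η hη
  refine eventually_abs_increment_sub_le h0 h1 (fun n => ?_) (ξ ω) u₀ hnode hWω
    (fun δ hδ => ?_) hη
  · have := hG n
    exact integrable_id_of_isGaussian _
  · have h5 := (hWsub.eventually_lt_const hδ).and
      (((hwlim (ξ ω)).comp hns.tendsto_atTop).eventually_lt_const hδ)
    obtain ⟨i, hi⟩ := h5.exists
    exact ⟨ns i, hi⟩

end IsObservationModel

/-! ### Consistency of the maximizers of the posterior mean -/

/-- A point which maximizes `m` nearly maximizes any function whose increments are uniformly close
to those of `m`. -/
lemma abs_sub_sup_le_of_abs_increment_sub_le {𝕏 : Type*} [MetricSpace 𝕏] [CompactSpace 𝕏]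
    {m : 𝕏 → ℝ} {g : C(𝕏, ℝ)} {u₀ v : 𝕏} {η : ℝ} (hv : ∀ u, m u ≤ m v)
    (h : ∀ u, |(m u - m u₀) - (g u - g u₀)| ≤ η) : |g v - ⨆ u, g u| ≤ 2 * η := by
  have : Nonempty 𝕏 := ⟨u₀⟩
  have h1 : (⨆ u, g u) ≤ g v + 2 * η := ciSup_le fun u => by
    linarith [hv u, abs_le.1 (h u), abs_le.1 (h v), (abs_le.1 (h u)).1, (abs_le.1 (h v)).2]
  rw [abs_sub_comm, abs_of_nonneg (sub_nonneg.2 (le_sup g v))]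
  linarith

end SeqDesign

theorem mainTheorem10 {𝕏 Ω : Type*} [MetricSpace 𝕏] [CompactSpace 𝕏]
    [MeasurableSpace 𝕏] [BorelSpace 𝕏] [MeasurableSpace Ω]
    (P : Measure Ω) [IsProbabilityMeasure P]
    (τ : 𝕏 → ℝ) (hτ : Continuous τ) (hτ_nonneg : ∀ x, 0 ≤ τ x)
    (ξ : Ω → C(𝕏, ℝ)) (hξ_meas : ∀ x, Measurable (fun ω => ξ ω x))
    (hξ : IsGaussianProcess (fun x ω => ξ ω x) P)
    (U : ℕ → Ω → ℝ) (hU_meas : ∀ n, Measurable (U n))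
    (hU_law : ∀ n, P.map (U n) = gaussianReal 0 1)
    (hU_indep : iIndepFun U P)
    (hξU : IndepFun ξ (fun ω n => U n ω) P)
    (X : ℕ → Ω → 𝕏)
    (hX : SeqDesign.IsSUR P τ ξ U X ∨ ∃ ε : ℕ → ℝ, SeqDesign.IsQuasiSUR P τ ξ U X ε)
    (xstar : ℕ → Ω → 𝕏)
    (hxstar_meas : ∀ n, Measurable[SeqDesign.dataAlgebra τ ξ U X n] (xstar n))
    (hxstar : ∀ n, ∀ᵐ ω ∂P, ∀ u : 𝕏,
      SeqDesign.meanFun (SeqDesign.posterior P τ ξ U X n ω) u ≤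
        SeqDesign.meanFun (SeqDesign.posterior P τ ξ U X n ω) (xstar n ω)) :
    (∀ᵐ ω ∂P, Tendsto (fun n => ξ ω (xstar n ω)) atTop (𝓝 (⨆ u, ξ ω u))) ∧
    (∀ n, Integrable (fun ω => ξ ω (xstar n ω)) P) ∧
    Integrable (fun ω => ⨆ u, ξ ω u) P ∧
    Tendsto (fun n => ∫ ω, |ξ ω (xstar n ω) - ⨆ u, ξ ω u| ∂P) atTop (𝓝 0) := by
  obtain ⟨ω₀⟩ : Nonempty Ω := nonempty_of_isProbabilityMeasure P
  have : Nonempty 𝕏 := ⟨X 0 ω₀⟩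
  -- a minimizing design is the case `ε = 0` of a nearly minimizing one
  obtain ⟨hdes, ε, hε, n₀, hopt⟩ : SeqDesign.IsSequentialDesign τ ξ U X ∧
      ∃ ε : ℕ → ℝ, Tendsto ε atTop (𝓝 0) ∧ ∃ n₀ : ℕ, ∀ n ≥ n₀, ∀ᵐ ω ∂P, ∀ x : 𝕏,
        SeqDesign.kgCriterion P τ ξ U X n (X n ω) ω
          ≤ SeqDesign.kgCriterion P τ ξ U X n x ω + ε n := by
    rcases hX with ⟨hdes, n₀, h⟩ | ⟨ε, hdes, -, hε, n₀, h⟩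
    · exact ⟨hdes, fun _ => 0, tendsto_const_nhds, n₀, by simpa using h⟩
    · exact ⟨hdes, ε, hε, n₀, h⟩
  have hmeas : Measurable ξ := SeqDesign.measurable_of_eval hξ_meas
  have M : SeqDesign.IsObservationModel P τ ξ U X :=
    { continuous_noise := hτ
      measurable_path := hmeas
      isGaussian_path := SeqDesign.isGaussian_map_of_isGaussianProcess hξ_meas hξ
      measurable_noise := hU_meas
      noise_law := hU_law
      iIndepFun_noise := hU_indep
      indepFun_path_noise := hξU
      isSequentialDesign := hdes }
  have hlim : ∀ᵐ ω ∂P, Tendsto (fun n => ξ ω (xstar n ω)) atTop (𝓝 (⨆ u, ξ ω u)) := by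
    filter_upwards [M.ae_eventually_abs_increment_sub_le hε hopt (X 0 ω₀), ae_all_iff.2 hxstar]
      with ω h1 h2
    refine Metric.tendsto_nhds.2 fun δ hδ => ?_
    filter_upwards [h1 (δ / 3) (by positivity)] with n hn
    rw [Real.dist_eq]
    linarith [SeqDesign.abs_sub_sup_le_of_abs_increment_sub_le (h2 n) hn]
  have hnorm := M.integrable_path.norm
  have hle : ∀ n ω, ‖ξ ω (xstar n ω)‖ ≤ ‖ξ ω‖ := fun n ω => (ξ ω).norm_coe_le_norm _
  have hint : ∀ n, Integrable (fun ω => ξ ω (xstar n ω)) P := fun n => by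
    have hx : Measurable (xstar n) :=
      (hxstar_meas n).mono (M.measurable_history n).comap_le le_rfl
    have hev : Measurable fun q : C(𝕏, ℝ) × 𝕏 => q.1 q.2 := continuous_eval.measurable
    exact hnorm.mono' (hev.comp (hmeas.prodMk hx)).aestronglyMeasurable
      (ae_of_all _ (hle n))
  have hsup := SeqDesign.integrable_sup M.integrable_path
  refine ⟨hlim, hint, hsup, ?_⟩
  have hdom := tendsto_integral_of_dominated_convergence (μ := P)
    (F := fun n ω => |ξ ω (xstar n ω) - ⨆ u, ξ ω u|) (f := fun _ => 0) (fun ω => 2 * ‖ξ ω‖)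
    (fun n => ((hint n).sub hsup).abs.1) (hnorm.const_mul 2)
    (fun n => ae_of_all _ fun ω => ?_) ?_
  · simpa using hdom
  · have h1 := hle n ω
    have h2 := SeqDesign.abs_sup_le_norm (ξ ω)
    have h3 := abs_sub (ξ ω (xstar n ω)) (⨆ u, ξ ω u)
    rw [Real.norm_eq_abs] at h1 ⊢
    rw [abs_abs]
    linarith
  · filter_upwards [hlim] with ω hω
    have := (hω.sub_const (⨆ u, ξ ω u)).abs
    simpa using this
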